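/- Let $T>0$, $\gamma>1/2$ and $\kappa\in(0,1)$ with $\gamma(1+\kappa)<1$, and let $\eta$ satisfy $\frac{1-\gamma(1+\kappa)}{\gamma}<\eta<1-\kappa$. Let $\sigma:\mathbb R\to\mathbb R$ satisfy: - $\sigma(0)=0$, and there is a constant $C$ with $|\sigma(\xi_2)-\sigma(\xi_1)|\le C\,\bigl||\xi_2|^\kappa-|\xi_1|^\kappa\bigr|$ for all $\xi_1,\xi_2\in\mathbb R$; - $\sigma$ is continuous and non-decreasing on $\mathbb R_+=[0,\infty)$; - $1/\sigma$ (with $1/0=\infty$) is integrable on every compact neighbourhood of $0$. Put $\phi(\xi)=\int_0^\xi \frac{ds}{\sigma(s)}$ for $\xi\in\mathbb R$. Then $\phi:\mathbb R\to\mathbb R$ is bijective, and the following holds. Let $x:[0,T]\to\mathbb R$ be $\gamma$-Hölder continuous with $x_0=0$ and $\int_0^T|\phi^{-1}(x_t)|^{-\eta}\,dt<\infty$ (with $0^{-\eta}=\infty$), and let $y_t=\phi^{-1}(x_t)$. Then $y$ is $\gamma$-Hölder continuous on $[0,T]$, is not identically zero, and solves $$y_t=\int_0^t\sigma(y_s)\,dx_s,\qquad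 t\in[0,T],$$ where the integral exists and has this value as a fractional integral of order $\alpha$, for every $\alpha$ in the non-empty interval $\bigl(1-\gamma,\gamma(\kappa+\eta)\bigr)$. Here the fractional integral of order $\alpha\in(0,1)$ is defined as follows. For $u\in L^1([a,b])$ let $I_{a+}^\alpha u_t=\frac1{\Gamma(\alpha)}\int_a^t(t-r)^{\alpha-1}u_r\,dr$ and $I_{b-}^\alpha u_t=\frac1{\Gamma(\alpha)}\int_t^b(r-t)^{\alpha-1}u_r\,dr$, and let $I_{a+}^\alpha(L^1)$, $I_{b-}^{\alpha}(L^1)$ denote the images of $L^1([a,b])$. For $f\in I_{a+}^\alpha(L^1)$ (resp. $f\in I_{b-}^\alpha(L^1)$), extended by $0$ outside $[a,b]$, put $$D_{a+}^\alpha f_t=\lim_{\varepsilon\downarrow0}\frac1{\Gamma(1-\alpha)}\Bigl(\frac{f_t}{(t-a)^\alpha}+\alpha\int_a^{t-\varepsilon}\frac{f_t-f_r}{(t-r)^{1+\alpha}}\,dr\Bigr),\qquad D_{b-}^\alpha f_t=\lim_{\varepsilon\downarrow0}\frac1{\Gamma(1-\alpha)}\Bigl(\frac{f_t}{(b-t)^\alpha}+\alpha\int_{t+\varepsilon}^{b}\frac{f_t-f_r}{(r-t)^{1+\alpha}}\,dr\Bigr),$$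 with limits in $L^1([a,b])$ and oriented integrals. If $f\in I_{a+}^\alpha(L^1)$, $g^{b-}:=g-g(b-)\in I_{b-}^{1-\alpha}(L^1)$ and $(D_{a+}^\alpha f)(D_{b-}^{1-\alpha}g^{b-})\in L^1([a,b])$, then $f$ is integrable with respect to $g$ with order $\alpha$, and $$\int_a^b f_r\,dg_r:=-\int_a^b (D_{a+}^\alpha f_r)\,(D_{b-}^{1-\alpha}g^{b-}_r)\,dr .$$ -/

import Mathlib

open Set Filter Topology MeasureTheory
open scoped ENNReal

noncomputable section

/-! Riemann-Liouville integrals, Marchaud derivatives and the extended Young integral. -/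

/-- The left-sided fractional integral `I_{a+}^α f` at `t`. -/
def fracIntLeft (α a : ℝ) (f : ℝ → ℝ) (t : ℝ) : ℝ :=
  (1 / Real.Gamma α) * ∫ r in a..t, (t - r) ^ (α - 1) * f r

/-- The right-sided fractional integral `I_{b-}^α f` at `t`. -/
def fracIntRight (α b : ℝ) (f : ℝ → ℝ) (t : ℝ) : ℝ :=
  (1 / Real.Gamma α) * ∫ r in t..b, (r - t) ^ (α - 1) * f r

/-- `f ∈ I_{a+}^α (L¹([a,b]))`. -/
def MemFracIntLeft (α a b : ℝ) (f : ℝ → ℝ) : Prop :=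
  ∃ u : ℝ → ℝ, IntegrableOn u (Icc a b) ∧
    f =ᵐ[volume.restrict (Icc a b)] fracIntLeft α a u

/-- `f ∈ I_{b-}^α (L¹([a,b]))`. -/
def MemFracIntRight (α a b : ℝ) (f : ℝ → ℝ) : Prop :=
  ∃ u : ℝ → ℝ, IntegrableOn u (Icc a b) ∧
    f =ᵐ[volume.restrict (Icc a b)] fracIntRight α b u

/-- The truncated left-sided derivative. The function `f` is extended by `0` outside `[a,b]`, and
the integral from `a` to `t - ε` is oriented, so that it also has a meaning for `t < a + ε`. -/
def truncDerivLeft (α a b : ℝ) (f : ℝ → ℝ) (ε t : ℝ) : ℝ :=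
  (1 / Real.Gamma (1 - α)) * (f t / (t - a) ^ α +
    α * ∫ r in a..(t - ε), (f t - (Icc a b).indicator f r) / (t - r) ^ (1 + α))

/-- The truncated right-sided derivative, with the same conventions. -/
def truncDerivRight (α a b : ℝ) (f : ℝ → ℝ) (ε t : ℝ) : ℝ :=
  (1 / Real.Gamma (1 - α)) * (f t / (b - t) ^ α +
    α * ∫ r in (t + ε)..b, (f t - (Icc a b).indicator f r) / (r - t) ^ (1 + α))

/-- `f ∈ I_{a+}^α (L¹([a,b]))`, and `D_{a+}^α f = u`: the truncated derivatives converge to `u`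
in `L¹([a,b])` as `ε ↓ 0`. -/
structure HasFracDerivLeft (α a b : ℝ) (f u : ℝ → ℝ) : Prop where
  mem : MemFracIntLeft α a b f
  integrable : IntegrableOn u (Icc a b)
  tendsto : Tendsto
    (fun ε : ℝ => eLpNorm (fun t => truncDerivLeft α a b f ε t - u t) 1
      (volume.restrict (Icc a b))) (𝓝[>] 0) (𝓝 0)

/-- `f ∈ I_{b-}^α (L¹([a,b]))`, and `D_{b-}^α f = u`: the truncated derivatives converge to `u`
in `L¹([a,b])` as `ε ↓ 0`. -/
structure HasFracDerivRight (α a b : ℝ) (f u : ℝ → ℝ) : Prop where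
  mem : MemFracIntRight α a b f
  integrable : IntegrableOn u (Icc a b)
  tendsto : Tendsto
    (fun ε : ℝ => eLpNorm (fun t => truncDerivRight α a b f ε t - u t) 1
      (volume.restrict (Icc a b))) (𝓝[>] 0) (𝓝 0)

/-- With differentiation order `α`, the function `f` is integrable with respect to `g` over
`[a,b]`, and the fractional integral `∫_a^b f dg` has the value `I`. Here `g^{b-} = g - g(b-)`.
The two derivatives above carry no factor `(-1)^α`; the product `(-1)^α (-1)^(1-α) = -1` of these
usual factors is the minus sign in front of the integral. With it the integral extends the
Young (Riemann-Stieltjes) integral. -/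
def HasFracIntegral (α a b : ℝ) (f g : ℝ → ℝ) (I : ℝ) : Prop :=
  ∃ u v : ℝ → ℝ, HasFracDerivLeft α a b f u ∧
    HasFracDerivRight (1 - α) a b (fun r => g r - Function.leftLim g b) v ∧
    IntegrableOn (fun r => u r * v r) (Icc a b) ∧
    I = -∫ r in a..b, u r * v r

/-! The coefficient and the Lamperti transform. -/

/-- The assumptions on the coefficient `σ`. The last one is stated with values in `[0,∞]`, with
`1 / 0 = ∞`, so that it forces `σ ≠ 0` almost everywhere. -/
structure PowerLikeCoeff (κ : ℝ) (σ : ℝ → ℝ) : Prop where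
  zero : σ 0 = 0
  bound : ∃ C : ℝ, ∀ ξ₁ ξ₂ : ℝ, |σ ξ₂ - σ ξ₁| ≤ C * |(|ξ₂| ^ κ - |ξ₁| ^ κ)|
  continuousOn : ContinuousOn σ (Ici 0)
  monotoneOn : MonotoneOn σ (Ici 0)
  inv_integrable : ∀ K : Set ℝ, IsCompact K → K ∈ 𝓝 (0 : ℝ) → ∫⁻ s in K, ‖σ s‖ₑ⁻¹ < ∞

/-- The Lamperti transform `φ(ξ) = ∫_0^ξ ds / σ(s)`. -/
def lamperti (σ : ℝ → ℝ) (ξ : ℝ) : ℝ := ∫ s in (0 : ℝ)..ξ, 1 / σ s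

/-- The inverse function `φ⁻¹` (meaningful as `φ` is bijective). -/
def lampertiInv (σ : ℝ → ℝ) : ℝ → ℝ := Function.invFun (lamperti σ)

end

/-! Write `ψ = φ⁻¹`, so that `ψ' = σ ∘ ψ` and the claim is the chain rule for `ψ(x)`. Young's theory
does not apply: a priori `σ(y)` is only `γκ`-Hölder, and `γκ < 1 - γ`. The integrability of
`|y|^(-η)` compensates for this. The inequality `||q|^κ - |p|^κ| ≤ |p|^(-η) |p - q|^(κ+η)` carries
its singular weight at one point only, so `σ(y)` satisfies a Hölder condition of the better order
`γ(κ+η) > 1 - γ` whose constant at time `t` is a multiple of `|y_t|^(-η)`, an integrable function of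
`t`.

This suffices for `f = σ(y)` to have a Marchaud derivative `u ∈ L¹` of every order `α < γ(κ+η)` with
`f = I^α u` (`LocalHolder.hasFracDerivLeft`). By reflection, `G = x - x_b` has a bounded right
derivative `v` of order `1 - α < γ`, and `I_{b-}^α G` at `s` equals `∫_s^b v`.

The value of the fractional integral is identified through difference quotients
(`LocalHolder.exists_fracDeriv`). Fractional integration by parts moves `I^α` from `u` to `(G(·+h) -
G)/h`, which turns it into the difference quotient of `s ↦ ∫_s^b v`. By dominated convergence `∫ f
(G(·+h) - G)/h` tends to `-∫ u v`, the fractional integral.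

The same limit can be computed by Taylor's formula: `y_{s+h} - y_s - σ(y_s)(x_{s+h} - x_s)` is at
most a constant times `|y_s|^(-η) h^(γ(κ+η+1))`, and the lower bound on `η` says exactly that this
exponent exceeds `1`. Hence the limit is also that of `∫ (y_{s+h} - y_s)/h ds`, namely `y_b - y_0 =
y_b`. -/

/-! ### Riemann-Liouville integrals: Beta integral, duality, semigroup property. -/

theorem integral_sub_rpow_mul_sub_rpow {α β r x : ℝ} (hα : 0 < α) (hβ : 0 < β) (hrx : r < x) :
    IntegrableOn (fun t => (t - r) ^ (β - 1) * (x - t) ^ (α - 1)) (Ioc r x) ∧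
    ∫ t in r..x, (t - r) ^ (β - 1) * (x - t) ^ (α - 1) =
      Real.Gamma α * Real.Gamma β / Real.Gamma (α + β) * (x - r) ^ (α + β - 1) := by
  have hx : 0 < x - r := sub_pos.2 hrx
  have key : ∫ t in r..x, (t - r) ^ (β - 1) * (x - t) ^ (α - 1) =
      Real.Gamma α * Real.Gamma β / Real.Gamma (α + β) * (x - r) ^ (α + β - 1) := by
    have h1 : ∫ t in r..x, (t - r) ^ (β - 1) * (x - t) ^ (α - 1) =
        ∫ s in (0 : ℝ)..(x - r), s ^ (β - 1) * (x - r - s) ^ (α - 1) := by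
      have := intervalIntegral.integral_comp_sub_right (a := r) (b := x)
        (fun s => s ^ (β - 1) * (x - r - s) ^ (α - 1)) r
      simpa using this
    rw [h1]
    apply Complex.ofReal_injective
    rw [← intervalIntegral.integral_ofReal]
    have h2 := Complex.betaIntegral_scaled (β : ℂ) (α : ℂ) hx
    rw [Complex.betaIntegral_eq_Gamma_mul_div _ _ (by simpa using hβ) (by simpa using hα)] at h2
    have h3 : ∫ s in (0 : ℝ)..(x - r), ((s ^ (β - 1) * (x - r - s) ^ (α - 1) : ℝ) : ℂ) =
        ∫ s in (0 : ℝ)..(x - r), (s : ℂ) ^ ((β : ℂ) - 1) * (((x - r : ℝ) : ℂ) - s) ^ ((α : ℂ) - 1) := by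
      refine intervalIntegral.integral_congr fun s hs => ?_
      rw [uIcc_of_le hx.le] at hs
      simp only [Complex.ofReal_mul]
      rw [Complex.ofReal_cpow hs.1, Complex.ofReal_cpow (sub_nonneg.2 hs.2)]
      push_cast
      rfl
    rw [h3, h2, Complex.Gamma_ofReal, Complex.Gamma_ofReal, ← Complex.ofReal_add,
      Complex.Gamma_ofReal]
    push_cast
    rw [Complex.ofReal_cpow hx.le]
    push_cast
    rw [add_comm (β : ℂ) α, add_comm β α]
    ring
  refine ⟨?_, key⟩
  rw [← intervalIntegrable_iff_integrableOn_Ioc_of_le hrx.le]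
  -- A non-integrable function has integral `0` by convention, so the nonzero value just computed
  -- proves integrability.
  refine not_imp_comm.1 intervalIntegral.integral_undef ?_
  rw [key]
  have := Real.Gamma_pos_of_pos hα
  have := Real.Gamma_pos_of_pos hβ
  have := Real.Gamma_pos_of_pos (add_pos hα hβ)
  positivity

/-- Fubini on the triangle `r < t`; the uniform bound `M` makes the kernel integrable against `u`.
The weight `w` may be unbounded, since the semigroup property needs `w t = (x - t)^(α-1)`. -/
theorem fracIntLeft_duality {a b β : ℝ} {u w : ℝ → ℝ} (hab : a ≤ b)
    (hu : IntegrableOn u (Ioc a b)) (hw : Measurable w) (M : ℝ)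
    (hint : ∀ r ∈ Ioo a b, IntegrableOn (fun t => (t - r) ^ (β - 1) * w t) (Ioc r b))
    (hM : ∀ r ∈ Ioo a b, ∫ t in r..b, (t - r) ^ (β - 1) * |w t| ≤ M) :
    IntegrableOn (fun t => w t * fracIntLeft β a u t) (Ioc a b) ∧
    ∫ t in a..b, w t * fracIntLeft β a u t = ∫ r in a..b, u r * fracIntRight β b w r := by
  set F : ℝ × ℝ → ℝ := fun p => {p : ℝ × ℝ | p.2 < p.1}.indicator
    (fun p => (p.1 - p.2) ^ (β - 1) * w p.1) p * u p.2 with hF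
  have hset : MeasurableSet {p : ℝ × ℝ | p.2 < p.1} :=
    measurableSet_lt measurable_snd measurable_fst
  have hmeas : AEStronglyMeasurable F
      ((volume.restrict (Ioc a b)).prod (volume.restrict (Ioc a b))) := by
    refine AEStronglyMeasurable.mul ?_ (hu.aestronglyMeasurable.comp_snd)
    refine Measurable.aestronglyMeasurable ?_
    refine Measurable.indicator ?_ hset
    fun_prop
  have hae : ∀ᵐ r ∂(volume.restrict (Ioc a b)), r ∈ Ioo a b := by
    rw [← restrict_Ioo_eq_restrict_Ioc]
    exact ae_restrict_mem measurableSet_Ioo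
  have hslice : ∀ r t, F (t, r) = (Ioi r).indicator (fun t => (t - r) ^ (β - 1) * w t * u r) t := by
    intro r t
    simp only [hF, indicator, mem_ofPred_eq, mem_Ioi]
    split_ifs <;> simp
  have hinter : ∀ r ∈ Ioo a b, Ioc a b ∩ Ioi r = Ioc r b := by
    intro r hr
    ext t
    simp only [mem_inter_iff, mem_Ioc, mem_Ioi]
    constructor
    · rintro ⟨⟨_, h⟩, h'⟩; exact ⟨h', h⟩
    · rintro ⟨h, h'⟩; exact ⟨⟨hr.1.trans h, h'⟩, h⟩
  have hslice_int : ∀ r ∈ Ioo a b, ∀ G : ℝ → ℝ,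
      ∫ t in Ioc a b, (Ioi r).indicator G t = ∫ t in r..b, G t := by
    intro r hr G
    rw [setIntegral_indicator measurableSet_Ioi, hinter r hr, intervalIntegral.integral_of_le hr.2.le]
  have hFint : Integrable F ((volume.restrict (Ioc a b)).prod (volume.restrict (Ioc a b))) := by
    rw [integrable_prod_iff' hmeas]
    constructor
    · filter_upwards [hae] with r hr
      simp_rw [hslice r]
      rw [integrable_indicator_iff measurableSet_Ioi, IntegrableOn,
        Measure.restrict_restrict measurableSet_Ioi, inter_comm, hinter r hr]
      exact (hint r hr).mul_const _
    · refine Integrable.mono' (hu.norm.const_mul M) ?_ ?_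
      · exact hmeas.norm.prod_swap.integral_prod_right'
      · filter_upwards [hae] with r hr
        simp_rw [hslice r, norm_indicator_eq_indicator_norm]
        rw [hslice_int r hr, Real.norm_eq_abs, abs_of_nonneg]
        · have h1 : ∫ t in r..b, ‖(t - r) ^ (β - 1) * w t * u r‖ =
              (∫ t in r..b, (t - r) ^ (β - 1) * |w t|) * ‖u r‖ := by
            rw [← intervalIntegral.integral_mul_const]
            refine intervalIntegral.integral_congr fun t ht => ?_
            rw [uIcc_of_le hr.2.le] at ht
            simp only [norm_mul, Real.norm_eq_abs]
            rw [abs_of_nonneg (Real.rpow_nonneg (sub_nonneg.2 ht.1) _)]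
          rw [h1]
          exact mul_le_mul_of_nonneg_right (hM r hr) (norm_nonneg _)
        · exact intervalIntegral.integral_nonneg hr.2.le fun _ _ => norm_nonneg _
  have hinner : ∀ t ∈ Ioc a b, ∫ r in Ioc a b, F (t, r) =
      w t * ∫ r in a..t, (t - r) ^ (β - 1) * u r := by
    intro t ht
    have : ∀ r, F (t, r) = (Iio t).indicator (fun r => w t * ((t - r) ^ (β - 1) * u r)) r := by
      intro r
      simp only [hF, indicator, mem_ofPred_eq, mem_Iio]
      split_ifs <;> ring
    simp_rw [this]
    have hi : Ioc a b ∩ Iio t = Ioo a t := by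
      ext r
      simp only [mem_inter_iff, mem_Ioc, mem_Iio, mem_Ioo]
      constructor
      · rintro ⟨⟨h, _⟩, h'⟩; exact ⟨h, h'⟩
      · rintro ⟨h, h'⟩; exact ⟨⟨h, h'.le.trans ht.2⟩, h'⟩
    rw [setIntegral_indicator measurableSet_Iio, hi, ← integral_Ioc_eq_integral_Ioo,
      intervalIntegral.integral_of_le ht.1.le, integral_const_mul]
  constructor
  · refine ((hFint.integral_prod_left).const_mul (1 / Real.Gamma β)).congr ?_
    filter_upwards [ae_restrict_mem measurableSet_Ioc] with t ht
    rw [hinner t ht, fracIntLeft]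
    ring
  · have hswap := integral_integral_swap (f := fun t r => F (t, r)) hFint
    rw [intervalIntegral.integral_of_le hab, intervalIntegral.integral_of_le hab]
    have h1 : ∫ t in Ioc a b, w t * fracIntLeft β a u t =
        (1 / Real.Gamma β) * ∫ t in Ioc a b, ∫ r in Ioc a b, F (t, r) := by
      rw [← integral_const_mul]
      refine setIntegral_congr_fun measurableSet_Ioc fun t ht => ?_
      simp only [hinner t ht, fracIntLeft]
      ring
    rw [h1, hswap, ← integral_const_mul]
    refine integral_congr_ae ?_
    filter_upwards [hae] with r hr
    simp_rw [hslice r]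
    rw [hslice_int r hr, intervalIntegral.integral_mul_const, fracIntRight]
    ring

theorem integrableOn_sub_rpow {β r b : ℝ} (hβ : 0 < β) :
    IntegrableOn (fun t => (t - r) ^ (β - 1)) (Ioc r b) := by
  rcases le_total r b with h | h
  · have := (intervalIntegral.intervalIntegrable_rpow' (a := 0) (b := b - r)
      (r := β - 1) (by linarith)).comp_sub_right r
    simp only [zero_add, sub_add_cancel] at this
    exact (intervalIntegrable_iff_integrableOn_Ioc_of_le h).1 this
  · simp [h]

theorem integral_sub_rpow {β r b : ℝ} (hβ : 0 < β) :
    ∫ t in r..b, (t - r) ^ (β - 1) = (b - r) ^ β / β := by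
  rw [intervalIntegral.integral_comp_sub_right (fun t => t ^ (β - 1)) r,
    integral_rpow (Or.inl (by linarith))]
  simp [hβ.ne']

theorem fracIntLeft_duality_of_bound {a b β : ℝ} {u w : ℝ → ℝ} (hab : a ≤ b) (hβ : 0 < β)
    (hu : IntegrableOn u (Ioc a b)) (hw : Measurable w) (M : ℝ) (hM : ∀ t, |w t| ≤ M) :
    IntegrableOn (fun t => w t * fracIntLeft β a u t) (Ioc a b) ∧
    ∫ t in a..b, w t * fracIntLeft β a u t = ∫ r in a..b, u r * fracIntRight β b w r := by
  have hI : ∀ r, IntegrableOn (fun t => (t - r) ^ (β - 1) * w t) (Ioc r b) := fun r =>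
    (integrableOn_sub_rpow hβ).mul_bdd (c := M) hw.aestronglyMeasurable (Eventually.of_forall hM)
  refine fracIntLeft_duality hab hu hw ((b - a) ^ β / β * M) (fun r _ => hI r) fun r hr => ?_
  have hM0 : 0 ≤ M := (abs_nonneg _).trans (hM 0)
  calc ∫ t in r..b, (t - r) ^ (β - 1) * |w t| ≤ ∫ t in r..b, (t - r) ^ (β - 1) * M := by
        refine intervalIntegral.integral_mono_on hr.2.le ?_ ?_ fun t ht => ?_
        · rw [intervalIntegrable_iff_integrableOn_Ioc_of_le hr.2.le]
          exact (integrableOn_sub_rpow hβ).mul_bdd (c := M) hw.abs.aestronglyMeasurable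
            (Eventually.of_forall fun t => by simpa using hM t)
        · rw [intervalIntegrable_iff_integrableOn_Ioc_of_le hr.2.le]
          exact (integrableOn_sub_rpow hβ).mul_const M
        · exact mul_le_mul_of_nonneg_left (hM t) (Real.rpow_nonneg (sub_nonneg.2 ht.1) _)
    _ = (b - r) ^ β / β * M := by
        rw [intervalIntegral.integral_mul_const, integral_sub_rpow hβ]
    _ ≤ (b - a) ^ β / β * M := by
        have := Real.rpow_le_rpow (sub_nonneg.2 hr.2.le) (sub_le_sub_left hr.1.le b) hβ.le
        gcongr

theorem integrableOn_fracIntLeft {a b β : ℝ} {u : ℝ → ℝ} (hab : a ≤ b) (hβ : 0 < β)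
    (hu : IntegrableOn u (Ioc a b)) : IntegrableOn (fracIntLeft β a u) (Ioc a b) := by
  simpa using (fracIntLeft_duality_of_bound hab hβ hu (measurable_const (a := (1 : ℝ))) 1
    (by simp)).1

theorem fracIntLeft_one (a : ℝ) (u : ℝ → ℝ) (t : ℝ) :
    fracIntLeft 1 a u t = ∫ r in a..t, u r := by
  simp [fracIntLeft]

/-- Duality plus the Beta integral. The condition `1 ≤ α + β` keeps the composed kernel `(x -
r)^(α+β-1)` bounded, so the identity holds at every `x` and not merely almost everywhere. -/
theorem fracIntLeft_fracIntLeft {a x α β : ℝ} {u : ℝ → ℝ} (hax : a ≤ x) (hα : 0 < α) (hβ : 0 < β)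
    (hαβ : 1 ≤ α + β) (hu : IntegrableOn u (Ioc a x)) :
    fracIntLeft α a (fracIntLeft β a u) x = fracIntLeft (α + β) a u x := by
  have hΓα := Real.Gamma_pos_of_pos hα
  have hΓβ := Real.Gamma_pos_of_pos hβ
  have hΓ := Real.Gamma_pos_of_pos (add_pos hα hβ)
  have key := (fracIntLeft_duality (β := β) (w := fun t => (x - t) ^ (α - 1)) hax hu (by fun_prop)
    (Real.Gamma α * Real.Gamma β / Real.Gamma (α + β) * (x - a) ^ (α + β - 1))
    (fun r hr => (integral_sub_rpow_mul_sub_rpow hα hβ hr.2).1) (fun r hr => ?_)).2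
  · rw [fracIntLeft, key, fracIntLeft, ← intervalIntegral.integral_const_mul,
      ← intervalIntegral.integral_const_mul]
    rw [intervalIntegral.integral_of_le hax, intervalIntegral.integral_of_le hax]
    rw [integral_Ioc_eq_integral_Ioo, integral_Ioc_eq_integral_Ioo]
    refine setIntegral_congr_fun measurableSet_Ioo fun r hr => ?_
    simp only [fracIntRight]
    rw [(integral_sub_rpow_mul_sub_rpow hα hβ hr.2).2]
    field_simp
  · have h1 : ∫ t in r..x, (t - r) ^ (β - 1) * |(x - t) ^ (α - 1)| =
        ∫ t in r..x, (t - r) ^ (β - 1) * (x - t) ^ (α - 1) := by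
      refine intervalIntegral.integral_congr fun t ht => ?_
      rw [uIcc_of_le hr.2.le] at ht
      rw [abs_of_nonneg (Real.rpow_nonneg (sub_nonneg.2 ht.2) _)]
    rw [h1, (integral_sub_rpow_mul_sub_rpow hα hβ hr.2).2]
    have := Real.rpow_le_rpow (sub_nonneg.2 hr.2.le) (sub_le_sub_left hr.1.le x)
      (sub_nonneg.2 hαβ)
    gcongr

/-! ### Marchaud derivatives under a Hölder condition with integrable constant. -/

/-- The function `f` is continuous, vanishes on `(-∞, a]`, and satisfies on `[a,b]` a Hölder
condition of order `δ` with an integrable local constant `h`. -/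
structure LocalHolder (δ a b : ℝ) (f h : ℝ → ℝ) : Prop where
  continuous : Continuous f
  eq_zero : ∀ r ≤ a, f r = 0
  integrable : IntegrableOn h (Icc a b)
  bound : ∀ᵐ t ∂volume.restrict (Icc a b), ∀ r ≤ t, |f t - f r| ≤ h t * (t - r) ^ δ

/-- The Marchaud derivative on the half-line. -/
noncomputable def marchaud (α : ℝ) (f : ℝ → ℝ) (t : ℝ) : ℝ :=
  α / Real.Gamma (1 - α) * ∫ s in Ioi (0 : ℝ), (f t - f (t - s)) * s ^ (-1 - α)

theorem integrableOn_min_rpow {α δ L : ℝ} (hα : 0 < α) (hαδ : α < δ) (hL : 0 < L) :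
    IntegrableOn (fun s => (min s L) ^ δ * s ^ (-1 - α)) (Ioi 0) := by
  rw [← Ioc_union_Ioi_eq_Ioi hL.le]
  refine IntegrableOn.union ?_ ?_
  · have : IntegrableOn (fun s : ℝ => s ^ (δ - 1 - α)) (Ioc 0 L) := by
      rw [← intervalIntegrable_iff_integrableOn_Ioc_of_le hL.le]
      exact intervalIntegral.intervalIntegrable_rpow' (by linarith)
    refine this.congr_fun (fun s hs => ?_) measurableSet_Ioc
    simp only
    rw [min_eq_left hs.2, ← Real.rpow_add hs.1]
    ring_nf
  · have : IntegrableOn (fun s : ℝ => L ^ δ * s ^ (-1 - α)) (Ioi L) :=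
      (integrableOn_Ioi_rpow_of_lt (by linarith) hL).const_mul _
    refine this.congr_fun (fun s hs => ?_) measurableSet_Ioi
    rw [min_eq_right (le_of_lt hs)]

theorem LocalHolder.nonneg_at {δ : ℝ} {f : ℝ → ℝ} {t ht : ℝ}
    (hb : ∀ r ≤ t, |f t - f r| ≤ ht * (t - r) ^ δ) : 0 ≤ ht := by
  have := (abs_nonneg _).trans (hb (t - 1) (by linarith))
  simpa using this

/-- A shift `s ≥ b - a` lands where `f` vanishes, so the increment stops growing. The resulting
majorant is integrable against `s^(-1-α)` both at `0` and at `∞`. -/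
theorem LocalHolder.abs_sub_le_min {δ a b : ℝ} {f h : ℝ → ℝ} (H : LocalHolder δ a b f h)
    (hδ : 0 < δ) {t ht : ℝ} (hat : a ≤ t) (htb : t ≤ b)
    (hb : ∀ r ≤ t, |f t - f r| ≤ ht * (t - r) ^ δ) {s : ℝ} (hs : 0 < s) :
    |f t - f (t - s)| ≤ ht * (min s (b - a)) ^ δ := by
  rcases le_total s (b - a) with h1 | h1
  · rw [min_eq_left h1]
    simpa using hb (t - s) (by linarith)
  · rw [min_eq_right h1, H.eq_zero (t - s) (by linarith), ← H.eq_zero a le_rfl]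
    refine (hb a hat).trans ?_
    exact mul_le_mul_of_nonneg_left
      (Real.rpow_le_rpow (by linarith) (by linarith) hδ.le) (LocalHolder.nonneg_at hb)

theorem LocalHolder.integrableOn_Ioi {δ a b α : ℝ} {f h : ℝ → ℝ} (H : LocalHolder δ a b f h)
    (hα : 0 < α) (hαδ : α < δ) (hab : a < b) {t ht : ℝ} (hat : a ≤ t) (htb : t ≤ b)
    (hb : ∀ r ≤ t, |f t - f r| ≤ ht * (t - r) ^ δ) :
    IntegrableOn (fun s => (f t - f (t - s)) * s ^ (-1 - α)) (Ioi 0) := by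
  have hc := H.continuous
  refine Integrable.mono' ((integrableOn_min_rpow hα hαδ (sub_pos.2 hab)).const_mul ht)
    (by fun_prop) ?_
  filter_upwards [ae_restrict_mem measurableSet_Ioi] with s (hs : 0 < s)
  rw [norm_mul, Real.norm_eq_abs, Real.norm_eq_abs, abs_of_nonneg (Real.rpow_nonneg hs.le _),
    ← mul_assoc]
  exact mul_le_mul_of_nonneg_right (H.abs_sub_le_min (hα.trans hαδ) hat htb hb hs)
    (Real.rpow_nonneg hs.le _)

theorem LocalHolder.abs_marchaud_le {δ a b α : ℝ} {f h : ℝ → ℝ} (H : LocalHolder δ a b f h)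
    (hα : 0 < α) (hα1 : α < 1) (hαδ : α < δ) (hab : a < b) {t ht : ℝ} (hat : a ≤ t) (htb : t ≤ b)
    (hb : ∀ r ≤ t, |f t - f r| ≤ ht * (t - r) ^ δ) :
    |marchaud α f t| ≤ α / Real.Gamma (1 - α) *
      (∫ s in Ioi (0 : ℝ), (min s (b - a)) ^ δ * s ^ (-1 - α)) * ht := by
  have hΓ := Real.Gamma_pos_of_pos (sub_pos.2 hα1)
  rw [marchaud, abs_mul, abs_of_nonneg (by positivity), mul_assoc]
  refine mul_le_mul_of_nonneg_left ?_ (by positivity)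
  rw [← integral_mul_const, ← Real.norm_eq_abs]
  refine norm_integral_le_of_norm_le ((integrableOn_min_rpow hα hαδ (sub_pos.2 hab)).mul_const ht) ?_
  filter_upwards [ae_restrict_mem measurableSet_Ioi] with s (hs : 0 < s)
  rw [norm_mul, Real.norm_eq_abs, Real.norm_eq_abs, abs_of_nonneg (Real.rpow_nonneg hs.le _),
    mul_comm _ ht, ← mul_assoc]
  exact mul_le_mul_of_nonneg_right (H.abs_sub_le_min (hα.trans hαδ) hat htb hb hs)
    (Real.rpow_nonneg hs.le _)

theorem measurable_marchaud {α : ℝ} {f : ℝ → ℝ} (hf : Continuous f) : Measurable (marchaud α f) := by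
  have : StronglyMeasurable (fun p : ℝ × ℝ => (f p.1 - f (p.1 - p.2)) * p.2 ^ (-1 - α)) := by
    refine Measurable.stronglyMeasurable ?_
    fun_prop
  exact (this.integral_prod_right' (ν := volume.restrict (Ioi (0 : ℝ)))).measurable.const_mul _

theorem LocalHolder.integrableOn_marchaud {δ a b α : ℝ} {f h : ℝ → ℝ} (H : LocalHolder δ a b f h)
    (hα : 0 < α) (hα1 : α < 1) (hαδ : α < δ) (hab : a < b) :
    IntegrableOn (marchaud α f) (Icc a b) := by
  refine Integrable.mono' (H.integrable.const_mul (α / Real.Gamma (1 - α) *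
      (∫ s in Ioi (0 : ℝ), (min s (b - a)) ^ δ * s ^ (-1 - α))))
    (measurable_marchaud H.continuous).aestronglyMeasurable ?_
  filter_upwards [H.bound, ae_restrict_mem measurableSet_Icc] with t hb ht
  exact H.abs_marchaud_le hα hα1 hαδ hab ht.1 ht.2 hb

/-- The boundary term `f t / (t - a)^α` is the part `s > t - a` of the half-line integral, where `f
(t - s) = 0`. Because the integral is oriented, this remains correct when `ε > t - a`. -/
theorem LocalHolder.truncDerivLeft_eq {δ a b α : ℝ} {f h : ℝ → ℝ} (H : LocalHolder δ a b f h)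
    (hα : 0 < α) {t ε : ℝ} (hε : 0 < ε) (hat : a < t) (htb : t ≤ b) :
    truncDerivLeft α a b f ε t =
      α / Real.Gamma (1 - α) * ∫ s in Ioi ε, (f t - f (t - s)) * s ^ (-1 - α) := by
  have hta : 0 < t - a := sub_pos.2 hat
  have hc := H.continuous
  have h1 : ∫ r in a..(t - ε), (f t - (Icc a b).indicator f r) / (t - r) ^ (1 + α) =
      ∫ s in ε..(t - a), (f t - f (t - s)) * s ^ (-1 - α) := by
    have h2 := intervalIntegral.integral_comp_sub_left (a := ε) (b := t - a)
      (fun r => (f t - f r) * (t - r) ^ (-1 - α)) t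
    simp only [sub_sub_cancel] at h2
    rw [h2]
    refine intervalIntegral.integral_congr fun r hr => ?_
    have hrt : r < t := by
      have := hr.2
      rcases le_total a (t - ε) with h | h
      · rw [sup_eq_right.2 h] at this; linarith
      · rw [sup_eq_left.2 h] at this; linarith
    have h3 : (Icc a b).indicator f r = f r := by
      by_cases har : a ≤ r
      · exact indicator_of_mem (mem_Icc.2 ⟨har, hrt.le.trans htb⟩) f
      · rw [indicator_of_notMem (fun h => har h.1), H.eq_zero r (le_of_not_ge har)]
    simp only [h3]
    rw [div_eq_mul_inv, ← Real.rpow_neg (sub_nonneg.2 hrt.le)]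
    congr 2
    ring
  have htail : EqOn (fun s => f t * s ^ (-1 - α)) (fun s => (f t - f (t - s)) * s ^ (-1 - α))
      (Ioi (t - a)) := by
    intro s (hs : t - a < s)
    simp only
    rw [H.eq_zero (t - s) (by linarith), sub_zero]
  have hint : IntegrableOn (fun s => (f t - f (t - s)) * s ^ (-1 - α)) (Ioi (t - a)) := by
    have : IntegrableOn (fun s : ℝ => f t * s ^ (-1 - α)) (Ioi (t - a)) :=
      (integrableOn_Ioi_rpow_of_lt (by linarith) hta).const_mul _
    exact this.congr_fun htail measurableSet_Ioi
  have hII : IntervalIntegrable (fun s => (f t - f (t - s)) * s ^ (-1 - α)) volume ε (t - a) := by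
    refine ContinuousOn.intervalIntegrable fun s hs => ?_
    have hs0 : 0 < s := (lt_min hε hta).trans_le hs.1
    have : ContinuousAt (fun s : ℝ => s ^ (-1 - α)) s :=
      Real.continuousAt_rpow_const _ _ (Or.inl hs0.ne')
    exact (ContinuousAt.mul (by fun_prop) this).continuousWithinAt
  rw [truncDerivLeft, h1, ← intervalIntegral.integral_interval_add_Ioi' hII hint,
    ← setIntegral_congr_fun measurableSet_Ioi htail, integral_const_mul,
    integral_Ioi_rpow_of_lt (by linarith) hta]
  have : -1 - α + 1 = -α := by ring
  rw [this, Real.rpow_neg hta.le]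
  have : (t - a) ^ α ≠ 0 := (Real.rpow_pos_of_pos hta _).ne'
  field_simp
  ring

/-- The difference is the integral over `0 < s ≤ ε`, dominated by `ht ∫_0^ε s^(δ-α-1) ds`. Since the
dependence on `ε` factors out, `L¹` convergence follows from integrability of the local constant. -/
theorem LocalHolder.abs_truncDerivLeft_sub_marchaud_le {δ a b α : ℝ} {f h : ℝ → ℝ}
    (H : LocalHolder δ a b f h) (hα : 0 < α) (hα1 : α < 1) (hαδ : α < δ) (hab : a < b) {t ht ε : ℝ}
    (hε : 0 < ε) (hat : a < t) (htb : t ≤ b) (hb : ∀ r ≤ t, |f t - f r| ≤ ht * (t - r) ^ δ) :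
    |truncDerivLeft α a b f ε t - marchaud α f t| ≤
      α / Real.Gamma (1 - α) * (ε ^ (δ - α) / (δ - α)) * ht := by
  have hΓ := Real.Gamma_pos_of_pos (sub_pos.2 hα1)
  have hI := H.integrableOn_Ioi hα hαδ hab hat.le htb hb
  have hsplit : ∫ s in Ioi (0 : ℝ), (f t - f (t - s)) * s ^ (-1 - α) =
      (∫ s in Ioc 0 ε, (f t - f (t - s)) * s ^ (-1 - α)) +
        ∫ s in Ioi ε, (f t - f (t - s)) * s ^ (-1 - α) := by
    rw [← setIntegral_union (Ioc_disjoint_Ioi le_rfl) measurableSet_Ioi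
      (hI.mono_set Ioc_subset_Ioi_self) (hI.mono_set (Ioi_subset_Ioi hε.le)),
      Ioc_union_Ioi_eq_Ioi hε.le]
  have hsmall : |∫ s in Ioc 0 ε, (f t - f (t - s)) * s ^ (-1 - α)| ≤
      ε ^ (δ - α) / (δ - α) * ht := by
    have h1 : ε ^ (δ - α) / (δ - α) * ht = ∫ s in Ioc 0 ε, s ^ (δ - α - 1) * ht := by
      rw [integral_mul_const, ← intervalIntegral.integral_of_le hε.le,
        integral_rpow (Or.inl (by linarith)), sub_add_cancel, Real.zero_rpow (by linarith), sub_zero]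
    rw [h1, ← Real.norm_eq_abs]
    refine norm_integral_le_of_norm_le ?_ ?_
    · refine Integrable.mul_const ?_ _
      rw [← IntegrableOn, ← intervalIntegrable_iff_integrableOn_Ioc_of_le hε.le]
      exact intervalIntegral.intervalIntegrable_rpow' (by linarith)
    · filter_upwards [ae_restrict_mem measurableSet_Ioc] with s hs
      have h2 : s ^ (δ - α - 1) = s ^ δ * s ^ (-1 - α) := by
        rw [← Real.rpow_add hs.1]; ring_nf
      rw [norm_mul, Real.norm_eq_abs, Real.norm_eq_abs,
        abs_of_nonneg (Real.rpow_nonneg hs.1.le _), h2, mul_comm _ ht, ← mul_assoc]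
      refine mul_le_mul_of_nonneg_right ?_ (Real.rpow_nonneg hs.1.le _)
      simpa using hb (t - s) (by linarith [hs.1])
  rw [H.truncDerivLeft_eq hα hε hat htb, marchaud, hsplit, ← mul_sub, sub_add_cancel_right, abs_mul,
    abs_neg, abs_of_nonneg (by positivity), mul_assoc]
  exact mul_le_mul_of_nonneg_left hsmall (by positivity)

theorem LocalHolder.tendsto_truncDerivLeft {δ a b α : ℝ} {f h : ℝ → ℝ}
    (H : LocalHolder δ a b f h) (hα : 0 < α) (hα1 : α < 1) (hαδ : α < δ) (hab : a < b) :
    Tendsto (fun ε : ℝ => eLpNorm (fun t => truncDerivLeft α a b f ε t - marchaud α f t) 1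
      (volume.restrict (Icc a b))) (𝓝[>] 0) (𝓝 0) := by
  set c : ℝ → ℝ := fun ε => α / Real.Gamma (1 - α) * (ε ^ (δ - α) / (δ - α)) with hc
  have hct : Tendsto c (𝓝[>] 0) (𝓝 0) := by
    have : ContinuousAt c 0 := by
      have := Real.continuousAt_rpow_const 0 (δ - α) (Or.inr (sub_pos.2 hαδ).le)
      fun_prop
    have h0 : c 0 = 0 := by simp [hc, Real.zero_rpow (sub_pos.2 hαδ).ne']
    have h1 := this.tendsto
    rw [h0] at h1
    exact h1.mono_left nhdsWithin_le_nhds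
  have hnorm : eLpNorm h 1 (volume.restrict (Icc a b)) ≠ ∞ :=
    (memLp_one_iff_integrable.2 H.integrable).eLpNorm_ne_top
  have hlim : Tendsto (fun ε => ‖c ε‖ₑ * eLpNorm h 1 (volume.restrict (Icc a b))) (𝓝[>] 0) (𝓝 0) := by
    have h1 : Tendsto (fun ε => ‖c ε‖ₑ) (𝓝[>] 0) (𝓝 0) := by
      simpa [Function.comp_def] using (continuous_enorm.tendsto (0 : ℝ)).comp hct
    simpa using ENNReal.Tendsto.mul_const h1 (Or.inr hnorm)
  have hmem : ∀ᵐ t ∂(volume.restrict (Icc a b)), t ∈ Ioc a b := by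
    rw [← restrict_Ioc_eq_restrict_Icc]
    exact ae_restrict_mem measurableSet_Ioc
  refine tendsto_of_tendsto_of_tendsto_of_le_of_le' tendsto_const_nhds hlim
    (Eventually.of_forall fun _ => zero_le) ?_
  filter_upwards [self_mem_nhdsWithin] with ε (hε : 0 < ε)
  rw [← eLpNorm_const_smul]
  refine eLpNorm_mono_ae ?_
  filter_upwards [H.bound, hmem] with t hb ht
  refine (H.abs_truncDerivLeft_sub_marchaud_le hα hα1 hαδ hab hε ht.1 ht.2 hb).trans ?_
  rw [Pi.smul_apply, smul_eq_mul]
  exact le_abs_self _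

/-- Integration by parts with `q s = ∫_{x-s}^x f` and the primitive `-s^(-α)/α`. The boundary term
vanishes at `0` because `q` is differentiable with `q 0 = 0` and `α < 1`, and at `∞` because `q` is
constant beyond `x - a`. -/
theorem integral_sub_primitive_mul_rpow {α a x : ℝ} {f : ℝ → ℝ} (hf : Continuous f)
    (hf0 : ∀ r ≤ a, f r = 0) (hα : 0 < α) (hα1 : α < 1) (hax : a ≤ x)
    (hint : IntegrableOn (fun s => (∫ t in (x - s)..x, f t) * s ^ (-1 - α)) (Ioi 0)) :
    α * ∫ s in Ioi (0 : ℝ), (∫ t in (x - s)..x, f t) * s ^ (-1 - α) =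
      ∫ r in a..x, (x - r) ^ (-α) * f r := by
  set q : ℝ → ℝ := fun s => ∫ t in (x - s)..x, f t with hq
  have hqd : ∀ s, HasDerivAt q (f (x - s)) s := by
    intro s
    have h1 : HasDerivAt (fun y => ∫ t in y..x, f t) (-f (x - s)) (x - s) :=
      intervalIntegral.integral_hasDerivAt_left (hf.intervalIntegrable _ _)
        hf.stronglyMeasurable.stronglyMeasurableAtFilter hf.continuousAt
    have h2 : HasDerivAt (fun s => x - s) (-1) s := by
      simpa using (hasDerivAt_id s).const_sub x
    exact (h1.comp s h2).congr_deriv (by simp)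
  have hvd : ∀ s ∈ Ioi (0 : ℝ), HasDerivAt (fun s : ℝ => -(s ^ (-α) / α)) (s ^ (-1 - α)) s := by
    intro s (hs : 0 < s)
    have h1 := ((Real.hasDerivAt_rpow_const (p := -α) (Or.inl hs.ne')).div_const α).neg
    refine h1.congr_deriv ?_
    have : -α - 1 = -1 - α := by ring
    rw [this]
    field_simp
  have hpow : ∀ s, x - a < s → f (x - s) * -(s ^ (-α) / α) = 0 := by
    intro s hs
    rw [hf0 (x - s) (by linarith), zero_mul]
  have hzero : EqOn (fun _ => (0 : ℝ)) (fun s => f (x - s) * -(s ^ (-α) / α)) (Ioi (x - a)) :=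
    fun s hs => (hpow s hs).symm
  have hIoc : IntegrableOn (fun s => f (x - s) * -(s ^ (-α) / α)) (Ioc 0 (x - a)) := by
    rw [← intervalIntegrable_iff_integrableOn_Ioc_of_le (sub_nonneg.2 hax)]
    refine IntervalIntegrable.continuousOn_mul ?_ (by fun_prop)
    exact ((intervalIntegral.intervalIntegrable_rpow' (by linarith)).div_const _).neg
  have hIoi : IntegrableOn (fun s => f (x - s) * -(s ^ (-α) / α)) (Ioi (x - a)) :=
    integrableOn_zero.congr_fun hzero measurableSet_Ioi
  have hunion := Ioc_union_Ioi_eq_Ioi (sub_nonneg.2 hax)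
  have h0 : Tendsto (q * fun s : ℝ => -(s ^ (-α) / α)) (𝓝[>] 0) (𝓝 0) := by
    have hs1 := (hasDerivAt_iff_tendsto_slope.1 (hqd 0)).mono_left
      (nhdsWithin_mono 0 (fun s (hs : 0 < s) => hs.ne'))
    have hs2 : Tendsto (fun s : ℝ => -(s ^ (1 - α) / α)) (𝓝[>] 0) (𝓝 0) := by
      have h1 : ContinuousAt (fun s : ℝ => -(s ^ (1 - α) / α)) 0 := by
        have := Real.continuousAt_rpow_const 0 (1 - α) (Or.inr (sub_pos.2 hα1).le)
        fun_prop
      have h2 := h1.tendsto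
      simp only [Real.zero_rpow (sub_pos.2 hα1).ne', zero_div, neg_zero] at h2
      exact h2.mono_left nhdsWithin_le_nhds
    have hs3 := hs1.mul hs2
    rw [mul_zero] at hs3
    refine hs3.congr' ?_
    filter_upwards [self_mem_nhdsWithin] with s (hs : 0 < s)
    have hq0 : q 0 = 0 := by simp [hq]
    have h1 : s ^ (1 - α) = s * s ^ (-α) := by
      rw [sub_eq_add_neg, Real.rpow_add hs, Real.rpow_one]
    have hs0 : s ≠ 0 := hs.ne'
    rw [slope_def_field, hq0, Pi.mul_apply, h1, sub_zero, sub_zero]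
    field_simp
  have hinf : Tendsto (q * fun s : ℝ => -(s ^ (-α) / α)) atTop (𝓝 0) := by
    have h1 : Tendsto (fun s : ℝ => q (x - a) * -(s ^ (-α) / α)) atTop (𝓝 0) := by
      simpa using ((tendsto_rpow_neg_atTop hα).div_const α).neg.const_mul (q (x - a))
    refine h1.congr' ?_
    filter_upwards [eventually_ge_atTop (x - a)] with s hs
    have h2 : q s = q (x - a) := by
      simp only [hq, sub_sub_cancel]
      rw [← intervalIntegral.integral_add_adjacent_intervals (b := a)
        (hf.intervalIntegrable _ _) (hf.intervalIntegrable _ _), add_eq_right]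
      rw [← intervalIntegral.integral_zero (a := x - s) (b := a) (μ := volume) (E := ℝ)]
      refine intervalIntegral.integral_congr fun r hr => ?_
      rw [uIcc_of_le (by linarith)] at hr
      exact hf0 r hr.2
    rw [Pi.mul_apply, h2]
  have hibp := integral_Ioi_mul_deriv_eq_deriv_mul (fun s _ => hqd s) hvd hint
    (by rw [← hunion]; exact hIoc.union hIoi) h0 hinf
  rw [hibp, ← hunion, setIntegral_union (Ioc_disjoint_Ioi le_rfl) measurableSet_Ioi hIoc hIoi,
    ← setIntegral_congr_fun measurableSet_Ioi hzero, integral_zero,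
    ← intervalIntegral.integral_of_le (sub_nonneg.2 hax), sub_self, zero_sub, add_zero]
  have h3 := intervalIntegral.integral_comp_sub_left (a := 0) (b := x - a)
    (fun r => (x - r) ^ (-α) * f r) x
  simp only [sub_sub_cancel, sub_zero] at h3
  rw [← h3, ← intervalIntegral.integral_neg, ← intervalIntegral.integral_const_mul]
  refine intervalIntegral.integral_congr fun s _ => ?_
  field_simp

/-- Integrating in `t` first turns the increment `f t - f (t - s)` into `∫_{x-s}^x f`, because `f`
vanishes below `a`; the preceding integration by parts then applies. -/
theorem LocalHolder.integral_marchaud {δ a b α : ℝ} {f h : ℝ → ℝ} (H : LocalHolder δ a b f h)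
    (hα : 0 < α) (hα1 : α < 1) (hαδ : α < δ) (hab : a < b) {x : ℝ} (hax : a ≤ x) (hxb : x ≤ b) :
    ∫ t in a..x, marchaud α f t = fracIntLeft (1 - α) a f x := by
  have hc := H.continuous
  set F : ℝ × ℝ → ℝ := fun p => (f p.1 - f (p.1 - p.2)) * p.2 ^ (-1 - α) with hF
  have hsub : Ioc a x ⊆ Icc a b := fun t ht => ⟨ht.1.le, ht.2.trans hxb⟩
  have hFint : Integrable F ((volume.restrict (Ioc a x)).prod (volume.restrict (Ioi (0 : ℝ)))) := by
    have hd := Integrable.mul_prod (H.integrable.mono_set hsub)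
      (integrableOn_min_rpow hα hαδ (sub_pos.2 hab))
    refine Integrable.mono' hd (Measurable.aestronglyMeasurable (by fun_prop)) ?_
    have h1 : ∀ᵐ t ∂volume.restrict (Ioc a x), t ∈ Icc a b ∧
        ∀ r ≤ t, |f t - f r| ≤ h t * (t - r) ^ δ := by
      filter_upwards [ae_restrict_of_ae_restrict_of_subset hsub H.bound,
        ae_restrict_mem measurableSet_Ioc] with t h1 h2 using ⟨hsub h2, h1⟩
    filter_upwards [Measure.quasiMeasurePreserving_fst.ae h1, Measure.quasiMeasurePreserving_snd.ae
      (ae_restrict_mem (μ := (volume : Measure ℝ)) (measurableSet_Ioi (a := (0 : ℝ))))] with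
      ⟨t, s⟩ ⟨ht, hb⟩ (hs : 0 < s)
    simp only [hF, norm_mul, Real.norm_eq_abs]
    rw [abs_of_nonneg (Real.rpow_nonneg hs.le _), ← mul_assoc]
    exact mul_le_mul_of_nonneg_right (H.abs_sub_le_min (hα.trans hαδ) ht.1 ht.2 hb hs)
      (Real.rpow_nonneg hs.le _)
  have hslice : ∀ s ∈ Ioi (0 : ℝ), ∫ t in Ioc a x, F (t, s) =
      (∫ t in (x - s)..x, f t) * s ^ (-1 - α) := by
    intro s (hs : 0 < s)
    simp only [hF]
    rw [integral_mul_const, ← intervalIntegral.integral_of_le hax,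
      intervalIntegral.integral_sub (hc.intervalIntegrable _ _)
        (Continuous.intervalIntegrable (by fun_prop) _ _),
      intervalIntegral.integral_comp_sub_right f s]
    congr 1
    have h1 : ∫ t in (a - s)..a, f t = 0 := by
      rw [← intervalIntegral.integral_zero (a := a - s) (b := a) (μ := volume) (E := ℝ)]
      refine intervalIntegral.integral_congr fun r hr => ?_
      rw [uIcc_of_le (by linarith)] at hr
      exact H.eq_zero r hr.2
    have h2 := intervalIntegral.integral_add_adjacent_intervals (a := a - s) (b := a) (c := x)
      (hc.intervalIntegrable (μ := volume) _ _) (hc.intervalIntegrable _ _)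
    have h3 := intervalIntegral.integral_add_adjacent_intervals (a := a - s) (b := x - s) (c := x)
      (hc.intervalIntegrable (μ := volume) _ _) (hc.intervalIntegrable _ _)
    linarith
  have hqint : IntegrableOn (fun s => (∫ t in (x - s)..x, f t) * s ^ (-1 - α)) (Ioi 0) := by
    refine hFint.integral_prod_right.congr ?_
    filter_upwards [ae_restrict_mem measurableSet_Ioi] with s hs using hslice s hs
  have hswap := integral_integral_swap (f := fun t s => F (t, s)) hFint
  rw [setIntegral_congr_fun measurableSet_Ioi hslice] at hswap
  have key := integral_sub_primitive_mul_rpow hc H.eq_zero hα hα1 hax hqint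
  simp only [marchaud]
  rw [intervalIntegral.integral_const_mul, intervalIntegral.integral_of_le hax, hswap, fracIntLeft]
  have : (1 - α) - 1 = -α := by ring
  rw [this, ← key]
  ring

theorem ae_eq_of_forall_integral_eq {a b : ℝ} {f g : ℝ → ℝ} (hf : IntegrableOn f (Icc a b))
    (hg : IntegrableOn g (Icc a b))
    (h : ∀ x ∈ Icc a b, ∫ t in a..x, f t = ∫ t in a..x, g t) :
    f =ᵐ[volume.restrict (Icc a b)] g := by
  rcases lt_or_ge b a with hba | hab
  · simp [Icc_eq_empty hba.not_ge, Measure.restrict_empty, EventuallyEq]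
  have hf' := ((intervalIntegrable_iff_integrableOn_Icc_of_le hab).2 hf).ae_hasDerivAt_integral
  have hg' := ((intervalIntegrable_iff_integrableOn_Icc_of_le hab).2 hg).ae_hasDerivAt_integral
  have hmem : ∀ᵐ t ∂(volume.restrict (Icc a b)), t ∈ Ioo a b := by
    rw [← restrict_Ioo_eq_restrict_Icc]
    exact ae_restrict_mem measurableSet_Ioo
  filter_upwards [ae_restrict_of_ae hf', ae_restrict_of_ae hg', hmem] with t h1 h2 ht
  have ht' : t ∈ uIcc a b := uIcc_of_le hab ▸ Ioo_subset_Icc_self ht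
  refine (h1 ht' a left_mem_uIcc).unique ((h2 ht' a left_mem_uIcc).congr_of_eventuallyEq ?_)
  filter_upwards [Icc_mem_nhds ht.1 ht.2] with x hx using h x hx

theorem fracIntLeft_congr {α a x : ℝ} {f g : ℝ → ℝ} (hax : a ≤ x) (h : EqOn f g (Icc a x)) :
    fracIntLeft α a f x = fracIntLeft α a g x := by
  rw [fracIntLeft, fracIntLeft]
  congr 1
  refine intervalIntegral.integral_congr fun r hr => ?_
  rw [uIcc_of_le hax] at hr
  simp only [h hr]

/-- Both sides have the same primitive: with `u` the Marchaud derivative, `I¹ f = I^α I^(1-α) f =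
I^α I¹ u = I¹ I^α u`. Every composition has total order at least `1`, so the pointwise semigroup
property suffices. -/
theorem LocalHolder.ae_eq_fracIntLeft_marchaud {δ a b α : ℝ} {f h : ℝ → ℝ}
    (H : LocalHolder δ a b f h) (hα : 0 < α) (hα1 : α < 1) (hαδ : α < δ) (hab : a < b) :
    f =ᵐ[volume.restrict (Icc a b)] fracIntLeft α a (marchaud α f) := by
  have hu := H.integrableOn_marchaud hα hα1 hαδ hab
  have hfi : ∀ x, IntegrableOn f (Ioc a x) := fun x =>
    (H.continuous.integrableOn_Icc).mono_set Ioc_subset_Icc_self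
  refine ae_eq_of_forall_integral_eq H.continuous.integrableOn_Icc ?_ fun x hx => ?_
  · rw [integrableOn_Icc_iff_integrableOn_Ioc]
    exact integrableOn_fracIntLeft hab.le hα (hu.mono_set Ioc_subset_Icc_self)
  · have hux : IntegrableOn (marchaud α f) (Ioc a x) :=
      hu.mono_set (Ioc_subset_Icc_self.trans (Icc_subset_Icc_right hx.2))
    calc ∫ t in a..x, f t = fracIntLeft (α + (1 - α)) a f x := by
          rw [add_sub_cancel, fracIntLeft_one]
      _ = fracIntLeft α a (fracIntLeft (1 - α) a f) x :=
          (fracIntLeft_fracIntLeft hx.1 hα (sub_pos.2 hα1) (by simp) (hfi x)).symm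
      _ = fracIntLeft α a (fracIntLeft 1 a (marchaud α f)) x := by
          refine fracIntLeft_congr hx.1 fun r hr => ?_
          rw [fracIntLeft_one, H.integral_marchaud hα hα1 hαδ hab hr.1 (hr.2.trans hx.2)]
      _ = fracIntLeft (α + 1) a (marchaud α f) x :=
          fracIntLeft_fracIntLeft hx.1 hα one_pos (by linarith) hux
      _ = fracIntLeft 1 a (fracIntLeft α a (marchaud α f)) x := by
          rw [fracIntLeft_fracIntLeft hx.1 one_pos hα (by linarith) hux, add_comm]
      _ = ∫ t in a..x, fracIntLeft α a (marchaud α f) t := fracIntLeft_one _ _ _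

theorem LocalHolder.hasFracDerivLeft {δ a b α : ℝ} {f h : ℝ → ℝ}
    (H : LocalHolder δ a b f h) (hα : 0 < α) (hα1 : α < 1) (hαδ : α < δ) (hab : a < b) :
    HasFracDerivLeft α a b f (marchaud α f) :=
  ⟨⟨_, H.integrableOn_marchaud hα hα1 hαδ hab, H.ae_eq_fracIntLeft_marchaud hα hα1 hαδ hab⟩,
    H.integrableOn_marchaud hα hα1 hαδ hab, H.tendsto_truncDerivLeft hα hα1 hαδ hab⟩

/-! ### From left to right by the reflection `t ↦ a + b - t`; dependence on `[a,b]` only. -/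

theorem fracIntRight_reflect (α a b : ℝ) (u : ℝ → ℝ) (t : ℝ) :
    fracIntRight α b (fun r => u (a + b - r)) t = fracIntLeft α a u (a + b - t) := by
  rw [fracIntRight, fracIntLeft]
  congr 1
  have := intervalIntegral.integral_comp_sub_left (a := t) (b := b)
    (fun r => (a + b - t - r) ^ (α - 1) * u r) (a + b)
  simp only [add_sub_cancel_right] at this
  rw [← this]
  refine intervalIntegral.integral_congr fun r _ => ?_
  congr 2
  ring

theorem truncDerivRight_reflect (α a b : ℝ) (f : ℝ → ℝ) (ε t : ℝ) :
    truncDerivRight α a b (fun r => f (a + b - r)) ε t =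
      truncDerivLeft α a b f ε (a + b - t) := by
  rw [truncDerivRight, truncDerivLeft]
  have := intervalIntegral.integral_comp_sub_left (a := t + ε) (b := b)
    (fun r => (f (a + b - t) - (Icc a b).indicator f r) / (a + b - t - r) ^ (1 + α)) (a + b)
  simp only [add_sub_cancel_right, ← sub_sub] at this
  have h1 : a + b - t - a = b - t := by ring
  rw [h1, ← this]
  congr 3
  refine intervalIntegral.integral_congr fun r _ => ?_
  have h2 : (Icc a b).indicator (fun r => f (a + b - r)) r =
      (Icc a b).indicator f (a + b - r) := by
    by_cases hr : r ∈ Icc a b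
    · rw [indicator_of_mem hr, indicator_of_mem]
      exact ⟨by linarith [hr.2], by linarith [hr.1]⟩
    · rw [indicator_of_notMem hr, indicator_of_notMem]
      exact fun h => hr ⟨by linarith [h.2], by linarith [h.1]⟩
  simp only [h2]
  congr 2
  ring

theorem measurePreserving_reflect (a b : ℝ) : MeasurePreserving (fun t => a + b - t)
    (volume.restrict (Icc a b)) (volume.restrict (Icc a b)) := by
  have := (Measure.measurePreserving_sub_left (volume : Measure ℝ) (a + b)).restrict_preimage
    (measurableSet_Icc (a := a) (b := b))
  simpa using this

theorem HasFracDerivLeft.reflect {α a b : ℝ} {f u : ℝ → ℝ} (h : HasFracDerivLeft α a b f u) :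
    HasFracDerivRight α a b (fun t => f (a + b - t)) (fun t => u (a + b - t)) := by
  have hmp := measurePreserving_reflect a b
  have hemb : MeasurableEmbedding (fun t : ℝ => a + b - t) :=
    (Homeomorph.subLeft (a + b)).measurableEmbedding
  have hint : ∀ u : ℝ → ℝ, IntegrableOn u (Icc a b) →
      IntegrableOn (fun t => u (a + b - t)) (Icc a b) := fun u hu =>
    (hmp.integrable_comp_emb hemb).2 hu
  obtain ⟨w, hw, hfw⟩ := h.mem
  refine ⟨⟨fun t => w (a + b - t), hint w hw, ?_⟩, hint u h.integrable, ?_⟩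
  · filter_upwards [hmp.quasiMeasurePreserving.ae hfw] with t ht
    rw [ht, fracIntRight_reflect]
  · refine h.tendsto.congr fun ε => ?_
    simp_rw [truncDerivRight_reflect]
    simp only [eLpNorm_one_eq_lintegral_enorm]
    exact (hmp.lintegral_comp_emb hemb
      (fun t => ‖truncDerivLeft α a b f ε t - u t‖ₑ)).symm

theorem HasFracDerivLeft.congr {α a b : ℝ} {f g u : ℝ → ℝ} (h : HasFracDerivLeft α a b f u)
    (hfg : EqOn f g (Icc a b)) : HasFracDerivLeft α a b g u := by
  have hind : (Icc a b).indicator f = (Icc a b).indicator g := indicator_congr hfg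
  obtain ⟨w, hw, hfw⟩ := h.mem
  refine ⟨⟨w, hw, ?_⟩, h.integrable, h.tendsto.congr fun ε => eLpNorm_congr_ae ?_⟩
  · filter_upwards [hfw, ae_restrict_mem measurableSet_Icc] with t h1 h2
    rw [← hfg h2, h1]
  · filter_upwards [ae_restrict_mem measurableSet_Icc] with t ht
    rw [truncDerivLeft, truncDerivLeft, hind, hfg ht]

theorem HasFracDerivRight.congr {α a b : ℝ} {f g u : ℝ → ℝ} (h : HasFracDerivRight α a b f u)
    (hfg : EqOn f g (Icc a b)) : HasFracDerivRight α a b g u := by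
  have hind : (Icc a b).indicator f = (Icc a b).indicator g := indicator_congr hfg
  obtain ⟨w, hw, hfw⟩ := h.mem
  refine ⟨⟨w, hw, ?_⟩, h.integrable, h.tendsto.congr fun ε => eLpNorm_congr_ae ?_⟩
  · filter_upwards [hfw, ae_restrict_mem measurableSet_Icc] with t h1 h2
    rw [← hfg h2, h1]
  · filter_upwards [ae_restrict_mem measurableSet_Icc] with t ht
    rw [truncDerivRight, truncDerivRight, hind, hfg ht]

/-! ### The fractional integral as a limit of integrals against difference quotients. -/

/-- Right fractional integration commutes with translation to the left, since `G` vanishes beyond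
`b` and the translated integral picks up nothing there. -/
theorem fracIntRight_eq_integral_of_shift {α b h s : ℝ} {G W : ℝ → ℝ} (hα : 0 < α)
    (hG : Continuous G) (hG0 : ∀ r, b ≤ r → G r = 0) (hh : 0 < h) (hsb : s ≤ b)
    (hW : ∀ r ∈ Icc s b, fracIntRight α b G r = W r) (hW0 : ∀ r, b ≤ r → W r = 0) :
    fracIntRight α b (fun r => (G (r + h) - G r) / h) s = (W (s + h) - W s) / h := by
  have hI : ∀ (F : ℝ → ℝ) (r c : ℝ), Continuous F → r ≤ c →
      IntervalIntegrable (fun t => (t - r) ^ (α - 1) * F t) volume r c := fun F r c hF hrc =>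
    ((intervalIntegrable_iff_integrableOn_Ioc_of_le hrc).2
      (integrableOn_sub_rpow hα)).mul_continuousOn hF.continuousOn
  have hzero : ∀ p q : ℝ, b ≤ p → p ≤ q → ∫ r in p..q, (r - (s + h)) ^ (α - 1) * G r = 0 := by
    intro p q hp hpq
    rw [← intervalIntegral.integral_zero (a := p) (b := q) (μ := volume) (E := ℝ)]
    refine intervalIntegral.integral_congr fun r hr => ?_
    rw [uIcc_of_le hpq] at hr
    simp only [hG0 r (hp.trans hr.1), mul_zero]
  have hshift : (1 / Real.Gamma α) * ∫ r in s..b, (r - s) ^ (α - 1) * G (r + h) = W (s + h) := by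
    have h1 := intervalIntegral.integral_comp_add_right (a := s) (b := b)
      (fun r => (r - (s + h)) ^ (α - 1) * G r) h
    simp only [add_sub_add_right_eq_sub] at h1
    rw [h1]
    rcases le_total (s + h) b with h2 | h2
    · rw [← hW (s + h) ⟨by linarith, h2⟩, fracIntRight,
        ← intervalIntegral.integral_add_adjacent_intervals (b := b) (hI G _ _ hG h2) ?_,
        hzero b (b + h) le_rfl (by linarith), add_zero]
      refine (hI G _ (b + h) hG (by linarith)).mono_set ?_
      rw [uIcc_of_le (by linarith), uIcc_of_le (by linarith)]
      exact Icc_subset_Icc_left h2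
    · rw [hW0 _ h2, hzero _ _ h2 (by linarith), mul_zero]
  have h3 : ∫ r in s..b, (r - s) ^ (α - 1) * ((G (r + h) - G r) / h) =
      ((∫ r in s..b, (r - s) ^ (α - 1) * G (r + h)) - ∫ r in s..b, (r - s) ^ (α - 1) * G r) / h := by
    rw [← intervalIntegral.integral_sub (hI _ _ _ (by fun_prop) hsb) (hI _ _ _ hG hsb),
      ← intervalIntegral.integral_div]
    refine intervalIntegral.integral_congr fun r _ => ?_
    ring
  rw [fracIntRight, h3, ← hshift, ← hW s ⟨le_rfl, hsb⟩, fracIntRight]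
  ring

/-- Lebesgue differentiation gives the limit `-V` almost everywhere; the quotients are bounded by
`M`, so `|u| M` dominates. -/
theorem tendsto_integral_mul_diff_quotient {a b M : ℝ} {u V : ℝ → ℝ} (hab : a ≤ b)
    (hu : IntegrableOn u (Icc a b)) (hV : Measurable V) (hM : ∀ t, |V t| ≤ M) (c : ℝ) :
    Tendsto (fun h : ℝ => ∫ s in a..b, u s * (((∫ r in (s + h)..c, V r) - ∫ r in s..c, V r) / h))
      (𝓝[>] 0) (𝓝 (-∫ s in a..b, u s * V s)) := by
  have hloc : LocallyIntegrable V volume := by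
    refine (locallyIntegrable_const M).mono hV.aestronglyMeasurable (Eventually.of_forall fun t => ?_)
    exact (hM t).trans (le_abs_self _)
  have hII : ∀ p q, IntervalIntegrable V volume p q := fun p q =>
    (hloc.integrableOn_isCompact isCompact_uIcc).intervalIntegrable
  have hdiff : ∀ s h, (∫ r in (s + h)..c, V r) - ∫ r in s..c, V r = -∫ r in s..(s + h), V r := by
    intro s h
    rw [← intervalIntegral.integral_add_adjacent_intervals (hII s (s + h)) (hII (s + h) c)]
    ring
  have huI : IntervalIntegrable u volume a b := (intervalIntegrable_iff_integrableOn_Icc_of_le hab).2 hu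
  rw [← intervalIntegral.integral_neg]
  refine intervalIntegral.tendsto_integral_filter_of_dominated_convergence (fun s => ‖u s‖ * M)
    ?_ ?_ (huI.norm.mul_const M) ?_
  · refine Eventually.of_forall fun h => ?_
    refine huI.aestronglyMeasurable_restrict_uIoc.mul ?_
    refine Continuous.aestronglyMeasurable ?_
    have h1 : Continuous fun s => ∫ r in s..c, V r := by
      simp_rw [intervalIntegral.integral_symm c]
      exact (intervalIntegral.continuous_primitive hII c).neg
    have h2 : Continuous fun s => ∫ r in (s + h)..c, V r := h1.comp (by fun_prop)
    exact (h2.sub h1).div_const h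
  · filter_upwards [self_mem_nhdsWithin] with h (hh : 0 < h)
    refine Eventually.of_forall fun s _ => ?_
    rw [norm_mul]
    refine mul_le_mul_of_nonneg_left ?_ (norm_nonneg _)
    rw [hdiff, norm_div, norm_neg, Real.norm_of_nonneg hh.le, div_le_iff₀ hh]
    have := intervalIntegral.norm_integral_le_of_norm_le_const (a := s) (b := s + h) (f := V) (C := M)
      (fun t _ => hM t)
    simpa [abs_of_pos hh] using this
  · filter_upwards [LocallyIntegrable.ae_hasDerivAt_integral hloc] with s hs _
    have h1 := ((hasDerivAt_iff_tendsto_slope_zero.1 (hs s)).mono_left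
      (nhdsWithin_mono 0 (fun s (hs : (0 : ℝ) < s) => hs.ne'))).neg.const_mul (u s)
    rw [← mul_neg]
    refine h1.congr fun h => ?_
    rw [hdiff, intervalIntegral.integral_same, sub_zero, smul_eq_mul]
    ring

theorem tendsto_integral_mul_increment {α a b B M : ℝ} {f u v G : ℝ → ℝ} (hα : 0 < α)
    (hab : a ≤ b) (hu : IntegrableOn u (Icc a b))
    (hfu : f =ᵐ[volume.restrict (Icc a b)] fracIntLeft α a u) (hG : Continuous G)
    (hG0 : ∀ r, b ≤ r → G r = 0) (hB : ∀ r, |G r| ≤ B) (hv : Measurable v)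
    (hM : ∀ t ∈ Icc a b, |v t| ≤ M) (hGv : ∀ s ∈ Icc a b, fracIntRight α b G s = ∫ r in s..b, v r) :
    Tendsto (fun h : ℝ => ∫ s in a..b, f s * ((G (s + h) - G s) / h)) (𝓝[>] 0)
      (𝓝 (-∫ s in a..b, u s * v s)) := by
  -- The cutoff makes `v` bounded on the whole line and makes `∫_s^b V` vanish for `s ≥ b`, matching
  -- the vanishing of `G` as the translation lemma requires.
  set V : ℝ → ℝ := (Icc a b).indicator v with hVdef
  have hV : Measurable V := hv.indicator measurableSet_Icc
  have hM0 : 0 ≤ M := (abs_nonneg _).trans (hM a ⟨le_rfl, hab⟩)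
  have hVM : ∀ t, |V t| ≤ M := by
    intro t
    by_cases ht : t ∈ Icc a b
    · rw [hVdef, indicator_of_mem ht]; exact hM t ht
    · rw [hVdef, indicator_of_notMem ht, abs_zero]; exact hM0
  have hVv : ∀ s ∈ Icc a b, ∫ r in s..b, V r = ∫ r in s..b, v r := by
    intro s hs
    refine intervalIntegral.integral_congr fun r hr => ?_
    rw [uIcc_of_le hs.2] at hr
    exact indicator_of_mem (mem_Icc.2 ⟨hs.1.trans hr.1, hr.2⟩) v
  have hW0 : ∀ r, b ≤ r → ∫ t in r..b, V t = 0 := by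
    intro r hr
    rw [intervalIntegral.integral_of_ge hr, neg_eq_zero]
    refine setIntegral_eq_zero_of_forall_eq_zero fun t ht => ?_
    exact indicator_of_notMem (fun h => ht.1.not_ge h.2) v
  have huv : ∫ s in a..b, u s * v s = ∫ s in a..b, u s * V s := by
    refine intervalIntegral.integral_congr fun r hr => ?_
    rw [uIcc_of_le hab] at hr
    simp only [hVdef, indicator_of_mem hr]
  rw [huv]
  refine (tendsto_integral_mul_diff_quotient hab hu hV hVM b).congr' ?_
  filter_upwards [self_mem_nhdsWithin] with h (hh : 0 < h)
  have hdual := (fracIntLeft_duality_of_bound (w := fun s => (G (s + h) - G s) / h) hab hα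
    (hu.mono_set Ioc_subset_Icc_self) (Continuous.measurable (by fun_prop)) ((B + B) / h)
    (fun t => ?_)).2
  · have h1 : ∫ s in a..b, f s * ((G (s + h) - G s) / h) =
        ∫ s in a..b, (G (s + h) - G s) / h * fracIntLeft α a u s := by
      rw [intervalIntegral.integral_of_le hab, intervalIntegral.integral_of_le hab]
      refine integral_congr_ae ?_
      filter_upwards [ae_restrict_of_ae_restrict_of_subset Ioc_subset_Icc_self hfu] with s hs
      rw [hs, mul_comm]
    rw [h1, hdual]
    refine intervalIntegral.integral_congr fun s hs => ?_
    rw [uIcc_of_le hab] at hs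
    have h2 := fracIntRight_eq_integral_of_shift (W := fun s => ∫ r in s..b, V r) hα hG hG0 hh hs.2
      (fun r hr => ?_) hW0
    · simp only [h2]
    · have hr' : r ∈ Icc a b := ⟨hs.1.trans hr.1, hr.2⟩
      rw [hGv r hr', hVv r hr']
  · rw [abs_div, abs_of_pos hh]
    gcongr
    exact (abs_sub _ _).trans (add_le_add (hB _) (hB _))

/-- An integrand `f` with integrable local Hölder constants and a Hölder continuous integrator
`G` vanishing at the right endpoint: both fractional derivatives exist, and the fractional integral
is the limit of the integrals against difference quotients. -/
theorem LocalHolder.exists_fracDeriv {α δ δ' a b B K : ℝ} {f h G : ℝ → ℝ} (hα : 0 < α) (hα1 : α < 1)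
    (hαδ : α < δ) (hαδ' : 1 - α < δ') (hab : a < b) (H : LocalHolder δ a b f h)
    (hG : Continuous G) (hG0 : ∀ r, b ≤ r → G r = 0) (hB : ∀ r, |G r| ≤ B)
    (hK : ∀ r s, |G r - G s| ≤ K * |r - s| ^ δ') :
    ∃ u v : ℝ → ℝ, HasFracDerivLeft α a b f u ∧ HasFracDerivRight (1 - α) a b G v ∧
      IntegrableOn (fun r => u r * v r) (Icc a b) ∧
      Tendsto (fun h : ℝ => ∫ s in a..b, f s * ((G (s + h) - G s) / h)) (𝓝[>] 0)
        (𝓝 (-∫ s in a..b, u s * v s)) := by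
  have hβ : 0 < 1 - α := sub_pos.2 hα1
  have hβ1 : 1 - α < 1 := by linarith
  have hb : ∀ t, ∀ r ≤ t, |G (a + b - t) - G (a + b - r)| ≤ K * (t - r) ^ δ' := by
    intro t r hrt
    refine (hK _ _).trans_eq ?_
    rw [abs_sub_comm, abs_of_nonneg (by linarith)]
    congr 2
    ring
  have HG : LocalHolder δ' a b (fun t => G (a + b - t)) (fun _ => K) :=
    ⟨by fun_prop, fun r hr => hG0 _ (by linarith), integrable_const _, Eventually.of_forall hb⟩
  set w := marchaud (1 - α) (fun t => G (a + b - t)) with hw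
  have hwm : Measurable w := measurable_marchaud HG.continuous
  have hvm : Measurable (fun t => w (a + b - t)) := hwm.comp (by fun_prop)
  have hu := H.integrableOn_marchaud hα hα1 hαδ hab
  have hM : ∀ t ∈ Icc a b, |w (a + b - t)| ≤ _ := fun t ht =>
    HG.abs_marchaud_le hβ hβ1 hαδ' hab (by linarith [ht.2]) (by linarith [ht.1]) (hb _)
  refine ⟨marchaud α f, fun t => w (a + b - t), H.hasFracDerivLeft hα hα1 hαδ hab, ?_, ?_, ?_⟩
  · simpa using (HG.hasFracDerivLeft hβ hβ1 hαδ' hab).reflect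
  · exact hu.mul_bdd hvm.aestronglyMeasurable
      ((ae_restrict_mem measurableSet_Icc).mono fun t ht => hM t ht)
  · refine tendsto_integral_mul_increment hα hab.le hu (H.ae_eq_fracIntLeft_marchaud hα hα1 hαδ hab)
      hG hG0 hB hvm hM fun s hs => ?_
    have h1 := fracIntRight_reflect α a b (fun t => G (a + b - t)) s
    simp only [sub_sub_cancel] at h1
    rw [h1]
    -- The derivative has order `1 - α`, so its primitive is a fractional integral of order `1 - (1
    -- - α) = α`: this is `I_{b-}^α G = ∫_s^b v` in reflected form.
    have h2 := HG.integral_marchaud hβ hβ1 hαδ' hab (x := a + b - s) (by linarith [hs.2])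
      (by linarith [hs.1])
    rw [sub_sub_cancel] at h2
    rw [← h2]
    have h3 := intervalIntegral.integral_comp_sub_left (a := s) (b := b) w (a + b)
    rw [h3, add_sub_cancel_right]

/-! ### The coefficient, the Lamperti transform and its inverse. -/

namespace PowerLikeCoeff

variable {κ : ℝ} {σ : ℝ → ℝ}

theorem even (hσ : PowerLikeCoeff κ σ) (ξ : ℝ) : σ (-ξ) = σ ξ := by
  obtain ⟨C, hC⟩ := hσ.bound
  have := hC ξ (-ξ)
  rw [abs_neg, sub_self, abs_zero, mul_zero] at this
  exact sub_eq_zero.1 (abs_nonpos_iff.1 this)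

theorem apply_abs (hσ : PowerLikeCoeff κ σ) (ξ : ℝ) : σ |ξ| = σ ξ := by
  rcases abs_choice ξ with h | h <;> rw [h]
  exact hσ.even ξ

theorem continuous (hσ : PowerLikeCoeff κ σ) : Continuous σ := by
  have h : Continuous fun ξ : ℝ => σ |ξ| :=
    hσ.continuousOn.comp_continuous continuous_abs fun ξ => abs_nonneg ξ
  simpa only [hσ.apply_abs] using h

theorem nonneg (hσ : PowerLikeCoeff κ σ) (ξ : ℝ) : 0 ≤ σ ξ := by
  rw [← hσ.apply_abs, ← hσ.zero]
  exact hσ.monotoneOn self_mem_Ici (abs_nonneg ξ) (abs_nonneg ξ)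

/-- By monotonicity and evenness, a zero at `ξ ≠ 0` would force `σ = 0` on `[-|ξ|, |ξ|]`, where `1/σ
= ∞` is not integrable. -/
theorem pos (hσ : PowerLikeCoeff κ σ) {ξ : ℝ} (hξ : ξ ≠ 0) : 0 < σ ξ := by
  refine (hσ.nonneg ξ).lt_of_ne' fun h0 => ?_
  have hξ' : 0 < |ξ| := abs_pos.2 hξ
  have hzero : ∀ s ∈ Icc (-|ξ|) |ξ|, σ s = 0 := by
    intro s hs
    refine le_antisymm ?_ (hσ.nonneg s)
    rw [← hσ.apply_abs, ← h0, ← hσ.apply_abs ξ]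
    exact hσ.monotoneOn (abs_nonneg s) (abs_nonneg ξ) (abs_le.2 hs)
  have := hσ.inv_integrable (Icc (-|ξ|) |ξ|) isCompact_Icc (Icc_mem_nhds (by linarith) hξ')
  rw [setLIntegral_congr_fun (g := fun _ => ∞) measurableSet_Icc
    (fun s hs => by simp [hzero s hs])] at this
  rw [setLIntegral_const, Real.volume_Icc, ENNReal.top_mul] at this
  · exact lt_irrefl _ this
  · simp only [ne_eq, ENNReal.ofReal_eq_zero, not_le]
    linarith

theorem exists_bound (hσ : PowerLikeCoeff κ σ) :
    ∃ C > 0, ∀ ξ₁ ξ₂ : ℝ, |σ ξ₂ - σ ξ₁| ≤ C * |(|ξ₂| ^ κ - |ξ₁| ^ κ)| := by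
  obtain ⟨C, hC⟩ := hσ.bound
  refine ⟨max C 1, by positivity, fun ξ₁ ξ₂ => (hC ξ₁ ξ₂).trans ?_⟩
  gcongr
  exact le_max_left _ _

theorem intervalIntegrable_inv (hσ : PowerLikeCoeff κ σ) (a b : ℝ) :
    IntervalIntegrable (fun s => 1 / σ s) volume a b := by
  set R := max |a| |b| + 1 with hR
  have hR0 : 0 < R := by positivity
  have h1 := hσ.inv_integrable (Icc (-R) R) isCompact_Icc (Icc_mem_nhds (by linarith) hR0)
  have h2 : IntegrableOn (fun s => 1 / σ s) (Icc (-R) R) := by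
    refine ⟨(measurable_const.div hσ.continuous.measurable).aestronglyMeasurable, ?_⟩
    refine lt_of_le_of_lt (lintegral_mono fun s => ?_) h1
    rcases eq_or_ne (σ s) 0 with h | h
    · simp [h]
    · simp [enorm_inv h]
  refine (h2.mono_set ?_).intervalIntegrable
  have ha := abs_le.1 (le_max_left |a| |b|)
  have hb := abs_le.1 (le_max_right |a| |b|)
  exact uIcc_subset_Icc ⟨by linarith [ha.1], by linarith [ha.2]⟩
    ⟨by linarith [hb.1], by linarith [hb.2]⟩

theorem continuous_lamperti (hσ : PowerLikeCoeff κ σ) : Continuous (lamperti σ) :=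
  intervalIntegral.continuous_primitive hσ.intervalIntegrable_inv 0

theorem lamperti_zero : lamperti σ 0 = 0 := by simp [lamperti]

theorem lamperti_neg (hσ : PowerLikeCoeff κ σ) (ξ : ℝ) : lamperti σ (-ξ) = -lamperti σ ξ := by
  rw [lamperti, lamperti, intervalIntegral.integral_symm]
  have := intervalIntegral.integral_comp_neg (a := 0) (b := ξ) (fun s => 1 / σ s)
  rw [neg_zero] at this
  rw [← this]
  simp_rw [hσ.even]

theorem hasDerivAt_lamperti (hσ : PowerLikeCoeff κ σ) {ξ : ℝ} (hξ : ξ ≠ 0) :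
    HasDerivAt (lamperti σ) (1 / σ ξ) ξ := by
  refine intervalIntegral.integral_hasDerivAt_right (hσ.intervalIntegrable_inv 0 ξ) ?_ ?_
  · exact (measurable_const.div hσ.continuous.measurable).stronglyMeasurable.stronglyMeasurableAtFilter
  · exact continuousAt_const.div hσ.continuous.continuousAt (hσ.pos hξ).ne'

theorem strictMono_lamperti (hσ : PowerLikeCoeff κ σ) : StrictMono (lamperti σ) := by
  have hd : ∀ ξ : ℝ, ξ ≠ 0 → 0 < deriv (lamperti σ) ξ := fun ξ hξ => by
    rw [(hσ.hasDerivAt_lamperti hξ).deriv]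
    exact one_div_pos.2 (hσ.pos hξ)
  refine StrictMonoOn.Iic_union_Ici (a := 0) ?_ ?_
  · refine strictMonoOn_of_deriv_pos (convex_Iic 0) hσ.continuous_lamperti.continuousOn fun ξ hξ => ?_
    rw [interior_Iic] at hξ
    exact hd ξ hξ.ne
  · refine strictMonoOn_of_deriv_pos (convex_Ici 0) hσ.continuous_lamperti.continuousOn fun ξ hξ => ?_
    rw [interior_Ici] at hξ
    exact hd ξ hξ.ne'

/-- Since `σ s ≤ C s^κ` with `κ < 1`, the transform grows at least like `ξ^(1-κ)`. -/
theorem tendsto_lamperti_atTop (hσ : PowerLikeCoeff κ σ) (hκ0 : 0 < κ) (hκ1 : κ < 1) :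
    Tendsto (lamperti σ) atTop atTop := by
  obtain ⟨C, hC0, hC⟩ := hσ.exists_bound
  have hle : ∀ s : ℝ, 0 ≤ s → σ s ≤ C * s ^ κ := by
    intro s hs
    have := hC 0 s
    rwa [hσ.zero, sub_zero, abs_zero, Real.zero_rpow hκ0.ne', sub_zero, abs_of_nonneg (hσ.nonneg s),
      abs_of_nonneg hs, abs_of_nonneg (Real.rpow_nonneg hs κ)] at this
  have hlow : Tendsto (fun ξ : ℝ => C⁻¹ * (ξ ^ (1 - κ) / (1 - κ))) atTop atTop :=
    ((tendsto_rpow_atTop (sub_pos.2 hκ1)).atTop_div_const (sub_pos.2 hκ1)).const_mul_atTop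
      (inv_pos.2 hC0)
  refine tendsto_atTop_mono' atTop ?_ hlow
  filter_upwards [eventually_ge_atTop 0] with ξ hξ
  have h1 : C⁻¹ * (ξ ^ (1 - κ) / (1 - κ)) = ∫ s in (0 : ℝ)..ξ, C⁻¹ * s ^ (-κ) := by
    rw [intervalIntegral.integral_const_mul, integral_rpow (Or.inl (by linarith)),
      neg_add_eq_sub, Real.zero_rpow (sub_pos.2 hκ1).ne', sub_zero]
  rw [h1, lamperti]
  refine intervalIntegral.integral_mono_on_of_le_Ioo hξ
    ((intervalIntegral.intervalIntegrable_rpow' (by linarith)).const_mul _)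
    (hσ.intervalIntegrable_inv 0 ξ) fun s hs => ?_
  have h2 := hle s hs.1.le
  have h3 := hσ.pos hs.1.ne'
  rw [Real.rpow_neg hs.1.le, ← mul_inv, one_div]
  exact inv_anti₀ h3 h2

theorem bijective_lamperti (hσ : PowerLikeCoeff κ σ) (hκ0 : 0 < κ) (hκ1 : κ < 1) :
    Function.Bijective (lamperti σ) := by
  refine ⟨hσ.strictMono_lamperti.injective, hσ.continuous_lamperti.surjective
    (hσ.tendsto_lamperti_atTop hκ0 hκ1) ?_⟩
  have h := (tendsto_neg_atTop_atBot.comp (hσ.tendsto_lamperti_atTop hκ0 hκ1)).comp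
    tendsto_neg_atBot_atTop
  refine h.congr fun ξ => ?_
  simp [hσ.lamperti_neg]

theorem lamperti_lampertiInv (hσ : PowerLikeCoeff κ σ) (hκ0 : 0 < κ) (hκ1 : κ < 1) (z : ℝ) :
    lamperti σ (lampertiInv σ z) = z :=
  Function.rightInverse_invFun (hσ.bijective_lamperti hκ0 hκ1).2 z

theorem lampertiInv_zero (hσ : PowerLikeCoeff κ σ) (hκ0 : 0 < κ) (hκ1 : κ < 1) :
    lampertiInv σ 0 = 0 := by
  apply hσ.strictMono_lamperti.injective
  rw [hσ.lamperti_lampertiInv hκ0 hκ1, lamperti_zero]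

theorem strictMono_lampertiInv (hσ : PowerLikeCoeff κ σ) (hκ0 : 0 < κ) (hκ1 : κ < 1) :
    StrictMono (lampertiInv σ) := by
  intro p q hpq
  rwa [← hσ.strictMono_lamperti.lt_iff_lt, hσ.lamperti_lampertiInv hκ0 hκ1,
    hσ.lamperti_lampertiInv hκ0 hκ1]

theorem continuous_lampertiInv (hσ : PowerLikeCoeff κ σ) (hκ0 : 0 < κ) (hκ1 : κ < 1) :
    Continuous (lampertiInv σ) :=
  (hσ.strictMono_lampertiInv hκ0 hκ1).monotone.continuous_of_surjective fun ξ =>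
    ⟨lamperti σ ξ, Function.leftInverse_invFun (hσ.bijective_lamperti hκ0 hκ1).1 ξ⟩

/-- Away from `0` this is the derivative of an inverse function. At `0`, where `1/σ` is singular,
the derivative extends because `σ ∘ φ⁻¹` is continuous. -/
theorem hasDerivAt_lampertiInv (hσ : PowerLikeCoeff κ σ) (hκ0 : 0 < κ) (hκ1 : κ < 1) (z : ℝ) :
    HasDerivAt (lampertiInv σ) (σ (lampertiInv σ z)) z := by
  have hc := hσ.continuous_lampertiInv hκ0 hκ1
  refine hasDerivAt_of_hasDerivAt_of_ne' (x := 0) (fun y hy => ?_) hc.continuousAt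
    (hσ.continuous.comp hc).continuousAt z
  have hy' : lampertiInv σ y ≠ 0 := by
    rw [← hσ.lampertiInv_zero hκ0 hκ1]
    exact (hσ.strictMono_lampertiInv hκ0 hκ1).injective.ne hy
  have hpos := hσ.pos hy'
  have h := HasDerivAt.of_local_left_inverse hc.continuousAt (hσ.hasDerivAt_lamperti hy')
    (one_div_pos.2 hpos).ne' (Eventually.of_forall (hσ.lamperti_lampertiInv hκ0 hκ1))
  simpa using h

end PowerLikeCoeff

/-! ### Weighted increment and Taylor estimates. -/

/-- For `x > y ≥ 0`, `x^κ - y^κ ≤ x^(κ-1) (x - y)`, and `x^(κ+η-1) ≤ (x - y)^(κ+η-1)` because that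
exponent is negative. This puts the weight at the larger modulus; if that is `|q|`, then `|q|^(-η) ≤
|p|^(-η)` moves it to `p`. -/
theorem abs_rpow_sub_rpow_le {κ η p q : ℝ} (hκ : 0 < κ) (hη0 : 0 < η) (hη : η < 1 - κ) (hp : p ≠ 0) :
    |(|q| ^ κ - |p| ^ κ)| ≤ |p| ^ (-η) * |p - q| ^ (κ + η) := by
  have key : ∀ x y : ℝ, 0 ≤ y → y < x → x ^ κ - y ^ κ ≤ x ^ (-η) * (x - y) ^ (κ + η) := by
    intro x y hy hyx
    have hx : 0 < x := hy.trans_lt hyx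
    have hxy : 0 < x - y := sub_pos.2 hyx
    have h1 : y / x ≤ (y / x) ^ κ := by
      have h2 : y / x ≤ 1 := (div_le_one hx).2 hyx.le
      simpa using Real.rpow_le_rpow_of_exponent_ge' (div_nonneg hy hx.le) h2 hκ.le
        (by linarith : κ ≤ 1)
    rw [Real.div_rpow hy hx.le] at h1
    have hxκ := Real.rpow_pos_of_pos hx κ
    have h2 : x ^ κ - y ^ κ ≤ x ^ κ * ((x - y) / x) := by
      rw [div_le_div_iff₀ hx hxκ] at h1
      rw [mul_div_assoc', le_div_iff₀ hx]
      nlinarith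
    have h3 : x ^ κ * ((x - y) / x) = x ^ (-η) * (x ^ (κ + η - 1) * (x - y)) := by
      rw [← mul_assoc, ← Real.rpow_add hx, show -η + (κ + η - 1) = κ - 1 by ring,
        Real.rpow_sub_one hx.ne']
      ring
    have h4 : x ^ (κ + η - 1) ≤ (x - y) ^ (κ + η - 1) :=
      Real.rpow_le_rpow_of_nonpos hxy (by linarith) (by linarith)
    have h5 : (x - y) ^ (κ + η - 1) * (x - y) = (x - y) ^ (κ + η) := by
      rw [Real.rpow_sub_one hxy.ne', div_mul_cancel₀ _ hxy.ne']
    refine h2.trans (h3.trans_le ?_)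
    rw [← h5]
    gcongr
  have hp' : 0 < |p| := abs_pos.2 hp
  have hsub : |(|p| - |q|)| ^ (κ + η) ≤ |p - q| ^ (κ + η) :=
    Real.rpow_le_rpow (abs_nonneg _) (abs_abs_sub_abs_le p q) (by linarith)
  refine le_trans ?_ (mul_le_mul_of_nonneg_left hsub (Real.rpow_nonneg hp'.le (-η)))
  rcases lt_trichotomy |q| |p| with h | h | h
  · rw [abs_sub_comm, abs_of_nonneg (sub_nonneg.2 (Real.rpow_le_rpow (abs_nonneg q) h.le hκ.le)),
      abs_of_pos (sub_pos.2 h)]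
    exact key _ _ (abs_nonneg q) h
  · rw [h, sub_self, abs_zero]
    positivity
  · rw [abs_of_nonneg (sub_nonneg.2 (Real.rpow_le_rpow hp'.le h.le hκ.le)), abs_sub_comm,
      abs_of_pos (sub_pos.2 h)]
    refine (key _ _ hp'.le h).trans ?_
    refine mul_le_mul_of_nonneg_right ?_ (Real.rpow_nonneg (sub_pos.2 h).le _)
    exact Real.rpow_le_rpow_of_nonpos hp' h.le (by linarith)

namespace PowerLikeCoeff

variable {κ : ℝ} {σ : ℝ → ℝ}

theorem exists_lipschitz_lampertiInv (hσ : PowerLikeCoeff κ σ) (hκ0 : 0 < κ) (hκ1 : κ < 1) (R : ℝ) :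
    ∃ M : NNReal, LipschitzOnWith M (lampertiInv σ) (Icc (-R) R) := by
  have hc : Continuous fun z => σ (lampertiInv σ z) :=
    hσ.continuous.comp (hσ.continuous_lampertiInv hκ0 hκ1)
  obtain ⟨M, hM⟩ := (isCompact_Icc (a := -R) (b := R)).exists_bound_of_continuousOn hc.continuousOn
  refine ⟨M.toNNReal, (convex_Icc _ _).lipschitzOnWith_of_nnnorm_hasDerivWithin_le
    (fun z _ => (hσ.hasDerivAt_lampertiInv hκ0 hκ1 z).hasDerivWithinAt) fun z hz => ?_⟩
  rw [← NNReal.coe_le_coe, coe_nnnorm]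
  exact (hM z hz).trans (Real.le_coe_toNNReal M)

theorem exists_abs_sub_le (hσ : PowerLikeCoeff κ σ) {η : ℝ} (hκ0 : 0 < κ) (hη0 : 0 < η)
    (hη : η < 1 - κ) (R : ℝ) :
    ∃ C > 0, ∀ p ∈ Icc (-R) R, ∀ q ∈ Icc (-R) R, lampertiInv σ p ≠ 0 →
      |σ (lampertiInv σ q) - σ (lampertiInv σ p)| ≤
        C * |lampertiInv σ p| ^ (-η) * |q - p| ^ (κ + η) := by
  obtain ⟨M, hM⟩ := hσ.exists_lipschitz_lampertiInv hκ0 (by linarith) R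
  obtain ⟨C, hC0, hC⟩ := hσ.exists_bound
  -- The Lipschitz constant `M` may be `0`; `M + 1` keeps the constant positive.
  refine ⟨C * (M + 1 : ℝ) ^ (κ + η), by positivity, fun p hp q hq hp0 => ?_⟩
  have h1 : |lampertiInv σ p - lampertiInv σ q| ≤ (M + 1) * |q - p| := by
    rw [abs_sub_comm]
    refine (hM.dist_le_mul q hq p hp).trans ?_
    rw [Real.dist_eq]
    gcongr
    linarith
  calc |σ (lampertiInv σ q) - σ (lampertiInv σ p)|
      ≤ C * |(|lampertiInv σ q| ^ κ - |lampertiInv σ p| ^ κ)| := hC _ _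
    _ ≤ C * (|lampertiInv σ p| ^ (-η) * |lampertiInv σ p - lampertiInv σ q| ^ (κ + η)) := by
        gcongr
        exact abs_rpow_sub_rpow_le hκ0 hη0 hη hp0
    _ ≤ C * (|lampertiInv σ p| ^ (-η) * ((M + 1) * |q - p|) ^ (κ + η)) := by gcongr
    _ = C * (M + 1 : ℝ) ^ (κ + η) * |lampertiInv σ p| ^ (-η) * |q - p| ^ (κ + η) := by
        rw [Real.mul_rpow (by positivity) (abs_nonneg _)]
        ring

/-- The mean value inequality for `z ↦ φ⁻¹(z) - σ(φ⁻¹(p)) z` between `p` and `q`; its derivative is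
the increment of `σ ∘ φ⁻¹` bounded in the hypothesis. -/
theorem abs_lampertiInv_sub_sub_le (hσ : PowerLikeCoeff κ σ) {R ρ D p q : ℝ} (hκ0 : 0 < κ)
    (hκ1 : κ < 1) (hD : 0 ≤ D) (hρ : 0 < ρ) (hp : p ∈ Icc (-R) R) (hq : q ∈ Icc (-R) R)
    (h : ∀ z ∈ Icc (-R) R, |σ (lampertiInv σ z) - σ (lampertiInv σ p)| ≤ D * |z - p| ^ ρ) :
    |lampertiInv σ q - lampertiInv σ p - σ (lampertiInv σ p) * (q - p)| ≤ D * |q - p| ^ (ρ + 1) := by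
  rcases eq_or_ne q p with rfl | hqp
  · simpa using mul_nonneg hD (Real.rpow_nonneg le_rfl _)
  have hsub : uIcc p q ⊆ Icc (-R) R := uIcc_subset_Icc hp hq
  have key := (convex_uIcc p q).norm_image_sub_le_of_norm_hasDerivWithin_le
    (f := fun z => lampertiInv σ z - σ (lampertiInv σ p) * z)
    (f' := fun z => σ (lampertiInv σ z) - σ (lampertiInv σ p)) (C := D * |q - p| ^ ρ)
    (fun z _ => ?_) (fun z hz => ?_) left_mem_uIcc right_mem_uIcc
  · rw [Real.rpow_add_one (abs_pos.2 (sub_ne_zero.2 hqp)).ne', ← mul_assoc]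
    simp only [Real.norm_eq_abs] at key
    refine le_of_eq_of_le ?_ key
    congr 1
    ring
  · refine ((hσ.hasDerivAt_lampertiInv hκ0 hκ1 z).sub ?_).hasDerivWithinAt
    simpa using (hasDerivAt_id z).const_mul (σ (lampertiInv σ p))
  · refine (h z (hsub hz)).trans ?_
    have : |z - p| ≤ |q - p| := abs_sub_left_of_mem_uIcc hz
    gcongr

end PowerLikeCoeff

/-! ### The chain rule and the equation. -/

/-- Replacing `f` times the increment of `X` by the increment of `Y` costs at most `h^(ρ-1) ∫ k`,
which tends to `0`. What remains telescopes to the averages of `Y` over `[b, b+h]` and `[a, a+h]`.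
-/
theorem tendsto_integral_of_increment_bound {a b ρ : ℝ} {f X Y k : ℝ → ℝ} (hab : a ≤ b) (hρ : 1 < ρ)
    (hf : Continuous f) (hX : Continuous X) (hY : Continuous Y)
    (hk : IntegrableOn k (Icc a b))
    (hbound : ∀ᵐ s ∂volume.restrict (Icc a b), ∀ h > 0,
      |Y (s + h) - Y s - f s * (X (s + h) - X s)| ≤ k s * h ^ ρ) :
    Tendsto (fun h : ℝ => ∫ s in a..b, f s * ((X (s + h) - X s) / h)) (𝓝[>] 0)
      (𝓝 (Y b - Y a)) := by
  have hYI : ∀ p q, IntervalIntegrable Y volume p q := hY.intervalIntegrable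
  have hmain : Tendsto (fun h : ℝ => (∫ s in a..b, (Y (s + h) - Y s)) / h) (𝓝[>] 0)
      (𝓝 (Y b - Y a)) := by
    have h1 : ∀ p, Tendsto (fun h : ℝ => (∫ s in p..(p + h), Y s) / h) (𝓝[>] 0) (𝓝 (Y p)) := by
      intro p
      have hd : HasDerivAt (fun t => ∫ s in p..t, Y s) (Y p) p := hY.integral_hasStrictDerivAt p p
        |>.hasDerivAt
      refine ((hasDerivAt_iff_tendsto_slope_zero.1 hd).mono_left
        (nhdsWithin_mono 0 (fun s (hs : (0 : ℝ) < s) => hs.ne'))).congr fun h => ?_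
      rw [intervalIntegral.integral_same, sub_zero, smul_eq_mul, div_eq_inv_mul]
    refine ((h1 b).sub (h1 a)).congr fun h => ?_
    rw [intervalIntegral.integral_sub (Continuous.intervalIntegrable (by fun_prop) _ _) (hYI _ _),
      intervalIntegral.integral_comp_add_right, ← sub_div]
    congr 1
    have e1 := intervalIntegral.integral_add_adjacent_intervals (hYI a b) (hYI b (b + h))
    have e2 := intervalIntegral.integral_add_adjacent_intervals (hYI a (a + h)) (hYI (a + h) (b + h))
    linarith
  have herr : Tendsto (fun h : ℝ => h ^ (ρ - 1) * ∫ s in Icc a b, k s) (𝓝[>] 0) (𝓝 0) := by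
    have h1 := (Real.continuousAt_rpow_const 0 (ρ - 1) (Or.inr (by linarith))).tendsto
    rw [Real.zero_rpow (by linarith)] at h1
    simpa using (h1.mono_left nhdsWithin_le_nhds).mul_const (∫ s in Icc a b, k s)
  have hdiff : Tendsto (fun h : ℝ => (∫ s in a..b, (Y (s + h) - Y s)) / h -
      ∫ s in a..b, f s * ((X (s + h) - X s) / h)) (𝓝[>] 0) (𝓝 0) := by
    refine squeeze_zero_norm' ?_ herr
    filter_upwards [self_mem_nhdsWithin] with h (hh : 0 < h)
    rw [← intervalIntegral.integral_div, ← intervalIntegral.integral_sub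
      (Continuous.intervalIntegrable (by fun_prop) _ _)
      (Continuous.intervalIntegrable (by fun_prop) _ _),
      intervalIntegral.integral_of_le hab, ← integral_Icc_eq_integral_Ioc, ← integral_const_mul]
    refine norm_integral_le_of_norm_le (hk.const_mul _) ?_
    filter_upwards [hbound] with s hs
    have h1 : (Y (s + h) - Y s) / h - f s * ((X (s + h) - X s) / h) =
        (Y (s + h) - Y s - f s * (X (s + h) - X s)) / h := by ring
    rw [h1, Real.norm_eq_abs, abs_div, abs_of_pos hh, div_le_iff₀ hh]
    refine (hs h hh).trans_eq ?_
    rw [Real.rpow_sub_one hh.ne']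
    field_simp
  simpa using hmain.sub hdiff

theorem hasFracIntegral_self (α a : ℝ) (f g : ℝ → ℝ) : HasFracIntegral α a a f g 0 := by
  exact ⟨0, 0, ⟨⟨0, integrableOn_zero, by simp [EventuallyEq]⟩, integrableOn_zero, by simp⟩,
    ⟨⟨0, integrableOn_zero, by simp [EventuallyEq]⟩, integrableOn_zero, by simp⟩,
    by simp [IntegrableOn], by simp⟩

theorem leftLim_eq_of_continuousOn_Icc {a b c : ℝ} {g : ℝ → ℝ} (hg : ContinuousOn g (Icc a c))
    (hab : a < b) (hbc : b ≤ c) : Function.leftLim g b = g b := by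
  refine leftLim_eq_of_tendsto ?_
  have h1 := (hg b ⟨hab.le, hbc⟩).mono
    (show Ioo a b ⊆ Icc a c from fun t ht => ⟨ht.1.le, ht.2.le.trans hbc⟩)
  rw [ContinuousWithinAt, nhdsWithin_Ioo_eq_nhdsLT hab] at h1
  exact h1

/-- The real power has `0^(-η) = 0`, unlike the extended one with value `∞`. That `Y` vanishes only
on a null set is therefore lost here and recorded in the next lemma. -/
theorem integrableOn_abs_rpow_neg {s : Set ℝ} {Y : ℝ → ℝ} {η : ℝ} (hη : 0 < η) (hY : Measurable Y)
    (hint : ∫⁻ t in s, ‖Y t‖ₑ ^ (-η) < ∞) : IntegrableOn (fun t => |Y t| ^ (-η)) s := by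
  refine ⟨Measurable.aestronglyMeasurable (by fun_prop), lt_of_le_of_lt (lintegral_mono fun t => ?_) hint⟩
  rcases eq_or_ne (Y t) 0 with h | h
  · simp [h, Real.zero_rpow (neg_ne_zero.2 hη.ne')]
  · rw [Real.enorm_eq_ofReal (Real.rpow_nonneg (abs_nonneg _) _),
      ← ENNReal.ofReal_rpow_of_pos (abs_pos.2 h), Real.enorm_eq_ofReal_abs]

theorem ae_ne_zero_of_lintegral_rpow_neg {s : Set ℝ} {Y : ℝ → ℝ} {η : ℝ} (hη : 0 < η)
    (hY : Measurable Y) (hint : ∫⁻ t in s, ‖Y t‖ₑ ^ (-η) < ∞) :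
    ∀ᵐ t ∂volume.restrict s, Y t ≠ 0 := by
  filter_upwards [ae_lt_top (by fun_prop) hint.ne] with t ht h0
  simp [h0, hη] at ht

/-- The chain rule `ψ(X_b) = ∫ σ(ψ(X)) dX` for `ψ` the inverse Lamperti transform. -/
theorem PowerLikeCoeff.exists_fracDeriv_of_holder {κ η γ α b K : ℝ} {σ X : ℝ → ℝ}
    (hσ : PowerLikeCoeff κ σ) (hκ0 : 0 < κ) (hη0 : 0 < η) (hη : η < 1 - κ)
    (hγ : 1 < γ * (κ + η + 1)) (hα : 0 < α) (hα1 : α < 1) (hαγ : 1 - α < γ)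
    (hαη : α < γ * (κ + η)) (hb : 0 < b) (hK0 : 0 ≤ K)
    (hX : ∀ r s, |X r - X s| ≤ K * |r - s| ^ γ) (hXc : Continuous X) (hX0 : ∀ s ≤ 0, X s = 0)
    (hXb : ∀ s, b ≤ s → X s = X b) {R : ℝ} (hR : ∀ s, X s ∈ Icc (-R) R)
    (hint : ∫⁻ t in Icc 0 b, ‖lampertiInv σ (X t)‖ₑ ^ (-η) < ∞) :
    ∃ u v : ℝ → ℝ, HasFracDerivLeft α 0 b (fun s => σ (lampertiInv σ (X s))) u ∧
      HasFracDerivRight (1 - α) 0 b (fun s => X s - X b) v ∧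
      IntegrableOn (fun r => u r * v r) (Icc 0 b) ∧
      lampertiInv σ (X b) = -∫ s in (0 : ℝ)..b, u s * v s := by
  have hκ1 : κ < 1 := by linarith
  have hψ := hσ.continuous_lampertiInv hκ0 hκ1
  have hψ0 := hσ.lampertiInv_zero hκ0 hκ1
  have hYc : Continuous fun s => lampertiInv σ (X s) := hψ.comp hXc
  have hfc : Continuous fun s => σ (lampertiInv σ (X s)) := hσ.continuous.comp hYc
  obtain ⟨C, hC0, hC⟩ := hσ.exists_abs_sub_le hκ0 hη0 hη R
  have hYint := integrableOn_abs_rpow_neg hη0 hYc.measurable hint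
  have hYne := ae_ne_zero_of_lintegral_rpow_neg hη0 hYc.measurable hint
  have hpow : ∀ r s ρ, 0 < ρ → |X r - X s| ^ ρ ≤ K ^ ρ * |r - s| ^ (γ * ρ) := by
    intro r s ρ hρ
    rw [Real.rpow_mul (abs_nonneg _), ← Real.mul_rpow hK0 (by positivity)]
    exact Real.rpow_le_rpow (abs_nonneg _) (hX r s) hρ.le
  have H : LocalHolder (γ * (κ + η)) 0 b (fun s => σ (lampertiInv σ (X s)))
      (fun t => C * K ^ (κ + η) * |lampertiInv σ (X t)| ^ (-η)) := by
    refine ⟨hfc, fun r hr => by simp only [hX0 r hr, hψ0, hσ.zero], hYint.const_mul _, ?_⟩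
    filter_upwards [hYne] with t ht r hrt
    rw [abs_sub_comm]
    refine (hC _ (hR t) _ (hR r) ht).trans ?_
    have h1 := hpow r t (κ + η) (by linarith)
    rw [abs_sub_comm r t, abs_of_nonneg (sub_nonneg.2 hrt)] at h1
    refine (mul_le_mul_of_nonneg_left h1 (by positivity)).trans_eq ?_
    ring
  obtain ⟨u, v, hu, hv, huv, hlim⟩ := H.exists_fracDeriv (G := fun s => X s - X b) (B := R + R)
    hα hα1 hαη hαγ hb (by fun_prop) (fun r hr => by rw [hXb r hr, sub_self])
    (fun r => (abs_sub _ _).trans (add_le_add (abs_le.2 (hR r)) (abs_le.2 (hR b))))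
    (fun r s => by simpa using hX r s)
  refine ⟨u, v, hu, hv, huv, ?_⟩
  simp only [sub_sub_sub_cancel_right] at hlim
  have hlim2 := tendsto_integral_of_increment_bound (ρ := γ * (κ + η + 1)) (X := X)
    (Y := fun s => lampertiInv σ (X s))
    (k := fun t => C * K ^ (κ + η + 1) * |lampertiInv σ (X t)| ^ (-η)) hb.le hγ hfc hXc hYc
    (hYint.const_mul _) ?_
  · have := tendsto_nhds_unique hlim2 hlim
    simpa [hX0 0 le_rfl, hψ0] using this
  · filter_upwards [hYne] with s hs h hh
    refine (hσ.abs_lampertiInv_sub_sub_le (D := C * |lampertiInv σ (X s)| ^ (-η)) (ρ := κ + η)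
      hκ0 hκ1 (by positivity) (by linarith) (hR s) (hR (s + h))
      fun z hz => hC _ (hR s) _ hz hs).trans ?_
    have h1 := hpow (s + h) s (κ + η + 1) (by linarith)
    rw [add_sub_cancel_left, abs_of_pos hh] at h1
    refine (mul_le_mul_of_nonneg_left h1 (by positivity)).trans_eq ?_
    ring

theorem mainTheorem3 (T : ℝ) (hT : 0 < T) (γ κ η : ℝ) (hγ : 1 / 2 < γ)
    (hκ0 : 0 < κ) (hκ1 : κ < 1) (hγκ : γ * (κ + 1) < 1)
    (hη₁ : (1 - γ * (1 + κ)) / γ < η) (hη₂ : η < 1 - κ)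
    (σ : ℝ → ℝ) (hσ : PowerLikeCoeff κ σ)
    (x : ℝ → ℝ) (hx : ∃ C, HolderOnWith C γ.toNNReal x (Icc 0 T)) (hx0 : x 0 = 0)
    (hint : ∫⁻ t in Icc 0 T, ‖lampertiInv σ (x t)‖ₑ ^ (-η) < ∞) :
    Function.Bijective (lamperti σ) ∧
    (∃ C, HolderOnWith C γ.toNNReal (fun t => lampertiInv σ (x t)) (Icc 0 T)) ∧
    (∃ t ∈ Icc 0 T, lampertiInv σ (x t) ≠ 0) ∧
    (Ioo (1 - γ) (γ * (κ + η))).Nonempty ∧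
    ∀ α ∈ Ioo (1 - γ) (γ * (κ + η)), ∀ t ∈ Icc 0 T,
      HasFracIntegral α 0 t (fun s => σ (lampertiInv σ (x s))) x (lampertiInv σ (x t)) := by
  obtain ⟨C, hC⟩ := hx
  have hγ0 : 0 < γ := by linarith
  have hη0 : 0 < η := lt_trans (div_pos (by linarith) hγ0) hη₁
  have hγη : 1 - γ * (1 + κ) < η * γ := (div_lt_iff₀ hγ0).1 hη₁
  have hγN : (γ.toNNReal : ℝ) = γ := Real.coe_toNNReal _ hγ0.le
  have hxc : ContinuousOn x (Icc 0 T) := hC.continuousOn (Real.toNNReal_pos.2 hγ0)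
  have hdist : ∀ r ∈ Icc 0 T, ∀ s ∈ Icc 0 T, |x r - x s| ≤ C * |r - s| ^ γ := by
    intro r hr s hs
    have := hC.dist_le hr hs
    rwa [Real.dist_eq, Real.dist_eq, hγN] at this
  set R : ℝ := C * T ^ γ
  have hR : ∀ s ∈ Icc 0 T, x s ∈ Icc (-R) R := by
    intro s hs
    have h1 := hdist s hs 0 ⟨le_rfl, hT.le⟩
    rw [hx0, sub_zero, sub_zero, abs_of_nonneg hs.1] at h1
    refine abs_le.1 (h1.trans ?_)
    exact mul_le_mul_of_nonneg_left (Real.rpow_le_rpow hs.1 hs.2 hγ0.le) C.2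
  refine ⟨hσ.bijective_lamperti hκ0 hκ1, ?_, ?_, nonempty_Ioo.2 (by linarith), ?_⟩
  · obtain ⟨M, hM⟩ := hσ.exists_lipschitz_lampertiInv hκ0 hκ1 R
    exact ⟨_, by simpa [Function.comp_def] using (holderOnWith_one.2 hM).comp hC hR⟩
  · by_contra! h0
    rw [setLIntegral_congr_fun (g := fun _ => ∞) measurableSet_Icc
      (fun t ht => by simp [h0 t ht, hη0])] at hint
    rw [setLIntegral_const, Real.volume_Icc, ENNReal.top_mul (by simpa using hT)] at hint
    exact lt_irrefl _ hint
  · intro α hα t ht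
    -- From `γ(κ+1) < 1`; then `α > 1 - γ > 0`, and `α < γ(κ+η) < γ < 1` because `κ + η < 1`.
    have hγ1 : γ < 1 := by nlinarith
    have hα0 : 0 < α := by linarith [hα.1]
    have hα1 : α < 1 := by nlinarith [hα.2]
    rcases eq_or_lt_of_le ht.1 with rfl | ht0
    · rw [hx0, hσ.lampertiInv_zero hκ0 hκ1]
      exact hasFracIntegral_self _ _ _ _
    have hproj : ∀ s, (projIcc 0 t ht.1 s : ℝ) ∈ Icc 0 T := fun s =>
      Icc_subset_Icc_right ht.2 (projIcc 0 t ht.1 s).2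
    -- The path is frozen outside `[0,t]`. The projection is `1`-Lipschitz, so `X` is Hölder on the
    -- whole line with the same constant, zero on the left and equal to `x t` on the right.
    set X : ℝ → ℝ := fun s => x (projIcc 0 t ht.1 s) with hXdef
    have hXx : EqOn X x (Icc 0 t) := fun s hs => by simp only [hXdef, projIcc_of_mem ht.1 hs]
    have hXt : X t = x t := hXx ⟨ht.1, le_rfl⟩
    have hXc : Continuous X :=
      hxc.comp_continuous (continuous_subtype_val.comp continuous_projIcc) hproj
    have hint' : ∫⁻ s in Icc 0 t, ‖lampertiInv σ (X s)‖ₑ ^ (-η) < ∞ := by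
      rw [setLIntegral_congr_fun measurableSet_Icc (fun s hs => by rw [hXx hs])]
      exact (lintegral_mono_set (Icc_subset_Icc_right ht.2)).trans_lt hint
    obtain ⟨u, v, hu, hv, huv, hval⟩ := hσ.exists_fracDeriv_of_holder (K := C) (X := X) hκ0 hη0 hη₂
      (by nlinarith) hα0 hα1 (by linarith [hα.1]) hα.2 ht0 C.2
      (fun r s => (hdist _ (hproj r) _ (hproj s)).trans (by
        have := abs_projIcc_sub_projIcc ht.1 (c := r) (d := s)
        gcongr))
      hXc (fun s hs => by simp only [hXdef, projIcc_of_le_left ht.1 hs, hx0])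
      (fun s hs => by simp only [hXdef, projIcc_of_right_le ht.1 hs, projIcc_right])
      (fun s => hR _ (hproj s)) hint'
    refine ⟨u, v, hu.congr fun s hs => by simp only [hXx hs], hv.congr fun s hs => ?_, huv, ?_⟩
    · simp only [hXx hs, hXt, leftLim_eq_of_continuousOn_Icc hxc ht0 ht.2]
    · rw [← hXt, hval]
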